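/- For $b\in\mathbb R$ let $F_b(x,y)=(|x|-y-1,\;x-|y|+b)$ on $\mathbb R^2$ and, for $4<b<8$, let $\Gamma_b\subset\mathbb R^2$ be the union of the five segments $$\overline{P_3P_{11}},\quad \overline{P_3P_5},\quad \overline{P_8P_6},\quad \overline{P_{11}P_9},\quad \overline{P_8P_{10}},$$ where $P_3=(-b-2,-1)$, $P_5=(b,-1)$, $P_6=(b+2,-3)$, $P_8=(0,b-1)$, $P_9=(b+4,2b-1)$, $P_{10}=(b,2b-1)$, $P_{11}=(b-2,2b-1)$. Then $\Gamma_b$ is compact and $F_b(\Gamma_b)=\Gamma_b$. Let $h_F(b)$ be the topological entropy of $F_b|_{\Gamma_b}$. Put $$p_n=\frac{4(4\cdot4^{n+1}-1)}{2\cdot4^{n+1}+1}\ (n\ge-1),\quad q_n=\frac{8\cdot4^{n+1}+1}{4^{n+1}+2},\quad r_n=\frac{16\cdot4^{n+1}-1}{2\cdot4^{n+1}+4},\quad s_n=\frac{2(4\cdot4^{n+2}-1)}{4^{n+2}+11}\quad(n\ge0).$$ For every $n\ge0$ one has $p_{n-1}<s_n<r_n<q_n<p_n$, and with $$S_n=(p_{n-1},s_n),\quad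 T_n=[s_n,r_n],\quad U_n=(r_n,q_n),\quad V_n=[q_n,p_n]$$ one has $(4,8)=\bigcup_{n\ge0}(S_n\cup T_n\cup U_n\cup V_n)$. Moreover $h_F(b)>0$ for all $b\in(4,8)$. Each of the following polynomials has a unique positive root, which is denoted as indicated: $$\begin{aligned} \alpha_n&:\ \lambda^{7+3n}-\lambda^{4+3n}-1, &\beta_n&:\ \lambda^{7+3n}-\lambda^{4+3n}-\lambda^3-2, &\delta_n&:\ \lambda^{7+3n}-\lambda^{4+3n}-2,\\ \gamma_n&:\ \lambda^{10+3n}-\lambda^{7+3n}-2\lambda^3-1, &\varphi_n&:\ \lambda^{10+3n}-\lambda^{7+3n}-\lambda^3-1, \end{aligned}$$ and, for every $n\ge0$: (a) if $b\in S_n$, then $\ln\alpha_n\le h_F(b)\le\ln\beta_n$; (b) if $b\in T_n$, then $h_F(b)=\ln\delta_n$; (c) if $b\in U_n$, then $\ln\alpha_n\le h_F(b)\le\ln\gamma_n$; (d) if $b\in V_n$, then $h_F(b)=\ln\varphi_n$. Furthermore $1<\alpha_n<\varphi_n<\delta_n<\gamma_n<\beta_n$ for every $n\ge0$; each of the five sequences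 is strictly decreasing and tends to $1$ as $n\to\infty$; hence the entropy $h_F(b)$ for $b\in S_n\cup T_n\cup U_n\cup V_n$ tends to $0$, uniformly in such $b$, as $n\to\infty$; and consequently $\lim_{b\to8^-}h_F(b)=0$. -/

import Mathlib

open Set Filter Topology

noncomputable section

namespace PWLinear

/-- The planar piecewise linear map `F(x,y) = (|x| - y + a, x - |y| + b)`. -/
def F (a b : ℝ) (z : ℝ × ℝ) : ℝ × ℝ :=
  (|z.1| - z.2 + a, z.1 - |z.2| + b)

/-- The invariant graph of `F (-1) b` for `4 < b < 8`: the union of the five segments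
`P₃P₁₁`, `P₃P₅`, `P₈P₆`, `P₁₁P₉` and `P₈P₁₀`, where `P₃ = (-b-2,-1)`, `P₅ = (b,-1)`,
`P₆ = (b+2,-3)`, `P₈ = (0,b-1)`, `P₉ = (b+4,2b-1)`, `P₁₀ = (b,2b-1)`, `P₁₁ = (b-2,2b-1)`.
The other vertices and marked points of the graph lie on these segments. -/
def Graph (b : ℝ) : Set (ℝ × ℝ) :=
  segment ℝ (-b - 2, -1) (b - 2, 2 * b - 1) ∪
  segment ℝ (-b - 2, -1) (b, -1) ∪
  segment ℝ (0, b - 1) (b + 2, -3) ∪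
  segment ℝ (b - 2, 2 * b - 1) (b + 4, 2 * b - 1) ∪
  segment ℝ (0, b - 1) (b, 2 * b - 1)

/-- The topological entropy of the restriction of `F (-1) b` to its invariant graph.
For an invariant set, `Dynamics.coverEntropy T K` is the (Bowen-Dinaburg) topological entropy
of the restriction of `T` to `K`, see `Dynamics.coverEntropy_restrict`. -/
def entropy (b : ℝ) : EReal :=
  Dynamics.coverEntropy (F (-1) b) (Graph b)

/-- The end points `p n`, with `n ≥ -1`. -/
def p (n : ℤ) : ℝ := 4 * (4 * 4 ^ (n + 1) - 1) / (2 * 4 ^ (n + 1) + 1)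

def q (n : ℕ) : ℝ := (8 * 4 ^ (n + 1) + 1) / (4 ^ (n + 1) + 2)

def r (n : ℕ) : ℝ := (16 * 4 ^ (n + 1) - 1) / (2 * 4 ^ (n + 1) + 4)

def s (n : ℕ) : ℝ := 2 * (4 * 4 ^ (n + 2) - 1) / (4 ^ (n + 2) + 11)

def S (n : ℕ) : Set ℝ := Ioo (p ((n : ℤ) - 1)) (s n)

def T (n : ℕ) : Set ℝ := Icc (s n) (r n)

def U (n : ℕ) : Set ℝ := Ioo (r n) (q n)

def V (n : ℕ) : Set ℝ := Icc (q n) (p n)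

section Polynomials

open Polynomial

def polyAlpha (n : ℕ) : ℝ[X] := X ^ (7 + 3 * n) - X ^ (4 + 3 * n) - 1

def polyBeta (n : ℕ) : ℝ[X] := X ^ (7 + 3 * n) - X ^ (4 + 3 * n) - X ^ 3 - 2

def polyDelta (n : ℕ) : ℝ[X] := X ^ (7 + 3 * n) - X ^ (4 + 3 * n) - 2

def polyGamma (n : ℕ) : ℝ[X] := X ^ (10 + 3 * n) - X ^ (7 + 3 * n) - 2 * X ^ 3 - 1

def polyPhi (n : ℕ) : ℝ[X] := X ^ (10 + 3 * n) - X ^ (7 + 3 * n) - X ^ 3 - 1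

/-- `x` is the unique positive root of the polynomial `P`. -/
def IsUniquePosRoot (P : ℝ[X]) (x : ℝ) : Prop :=
  (0 < x ∧ P.IsRoot x) ∧ ∀ y : ℝ, 0 < y → P.IsRoot y → y = x

end Polynomials

end PWLinear

end

/-! On the arc `A`, parametrised by the first coordinate, the third iterate of F has a repelling
fixed point f = `fixedPt b` = -(b+4)/3 with multiplier 4. Everything is governed by the returns to J
= [f, 4 - b], which has length t = (16 - 2b)/3. Write a point of `A` as f + w. Each turn of three
steps multiplies w by 4, until the point enters the folding zone [-3/2, 0] or jumps past 0, where F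
is constant. Two windows of the folding zone return to J: the direct one, w in [b/2, (b+4)/3], is
mapped onto J by four steps, and the reversing one, w in [(2b-1)/6, (7b+4)/24], by seven steps. What
lies between them ends up left of f, where complexity grows only linearly.

The part [f, f + t/4] of J returns after time 3. The rest is a fundamental domain of the
multiplication by 4, and n turns carry it to w in [Q/4, Q] with Q = 4^n t. The level n of b is
determined by Q < (b+4)/3 ≤ 4Q, which is p_{n-1} < b ≤ p_n. The part of a window below Q is met
after n turns, the part above Q after n+1 turns. So the position of Q relative to the windows
decides the return times. A window not cut by Q gives one return time; a window cut by Q is counted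
twice in the upper bound and dropped in the lower bound. This yields the lists `timesAlpha`, ...,
`timesPhi`. For return times k_i the growth rate is the root of Σ x^(-k_i) = 1, which is the stated
polynomial equation after clearing denominators. All times except 3 grow with n, so the roots tend
to 1.

Upper bounds (`entropy_le_log`): the number of cuts needed to split J into pieces with ε-close
orbits up to time n satisfies a renewal inequality with delays k_i. Lower bounds (`log_le_entropy`,
from `log_le_coverEntropy_of_branches`): the inverse branches of the return map are composed into
words, and many words share one total time, which gives a horseshoe. -/

namespace Dynamics

/-! ### Lower bounds for the entropy from inverse branches -/

open scoped Uniformity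

/-- If `T^[N]` has finitely many inverse branches on `K` whose images are uniformly separated, then
the entropy is at least the logarithm of their number, divided by `N`. -/
theorem log_card_div_le_coverEntropy {X κ : Type*} [PseudoMetricSpace X] [Fintype κ] [Nonempty κ]
    {T : X → X} {G K : Set X} (h : κ → X → X) {N : ℕ} (hN : 0 < N) (hKG : K ⊆ G)
    (hne : K.Nonempty) (hK : ∀ i, MapsTo (h i) K K) (hT : ∀ i, ∀ x ∈ K, T^[N] (h i x) = x)
    {ε : ℝ} (hε : 0 < ε)
    (hsep : ∀ i j, i ≠ j → ∀ x ∈ K, ∀ y ∈ K, ε ≤ dist (h i x) (h j y)) :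
    ((Real.log (Fintype.card κ) / N : ℝ) : EReal) ≤ coverEntropy T G := by
  classical
  have key : ∀ k : ℕ, ∃ s : Finset X, (s : Set X) ⊆ K ∧ s.card = Fintype.card κ ^ k ∧
      ∀ x ∈ s, ∀ y ∈ s, x ≠ y → ∃ j < N * k, ε ≤ dist (T^[j] x) (T^[j] y) := by
    intro k
    induction k with
    | zero =>
      obtain ⟨x, hx⟩ := hne
      exact ⟨{x}, by simpa using hx, by simp, by simp⟩
    | succ k ih =>
      obtain ⟨s, hsK, hcard, hs⟩ := ih
      refine ⟨Finset.univ.biUnion fun i => s.image (h i), ?_, ?_, ?_⟩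
      · intro x hx
        simp only [Finset.coe_biUnion, Finset.coe_univ, mem_univ, iUnion_true, Finset.coe_image,
          mem_iUnion, mem_image] at hx
        obtain ⟨i, y, hy, rfl⟩ := hx
        exact hK i (hsK hy)
      · rw [Finset.card_biUnion]
        · have : ∀ i, (s.image (h i)).card = s.card := fun i =>
            Finset.card_image_of_injOn fun x hx y hy hxy => by
              have hxy : h i x = h i y := hxy
              rw [← hT i x (hsK hx), ← hT i y (hsK hy), hxy]
          simp [this, hcard, pow_succ, mul_comm]
        · intro i _ j _ hij
          rw [Function.onFun, Finset.disjoint_left]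
          intro z hz hz'
          simp only [Finset.mem_image] at hz hz'
          obtain ⟨x, hx, rfl⟩ := hz
          obtain ⟨y, hy, hxy⟩ := hz'
          have := hsep i j hij x (hsK hx) y (hsK hy)
          rw [hxy, dist_self] at this
          linarith
      · intro x hx y hy hxy
        simp only [Finset.mem_biUnion, Finset.mem_univ, true_and, Finset.mem_image] at hx hy
        obtain ⟨i, x, hx, rfl⟩ := hx
        obtain ⟨j, y, hy, rfl⟩ := hy
        by_cases hij : i = j
        · subst hij
          obtain ⟨m, hm, hd⟩ := hs x hx y hy (fun h' => hxy (by rw [h']))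
          refine ⟨m + N, by rw [mul_add]; omega, ?_⟩
          rwa [Function.iterate_add_apply, Function.iterate_add_apply, hT i x (hsK hx),
            hT i y (hsK hy)]
        · exact ⟨0, by positivity, hsep i j hij x (hsK hx) y (hsK hy)⟩
  -- Half the separation constant makes the dynamical balls around ε-separated points disjoint.
  have hU : {q : X × X | dist q.1 q.2 < ε / 2} ∈ 𝓤 X := Metric.dist_mem_uniformity (by linarith)
  refine le_trans ?_ (netEntropyEntourage_le_coverEntropy T G hU)
  -- The growth rate is a limsup, so the times N * a suffice.
  apply Frequently.le_expGrowthSup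
  rw [frequently_atTop]
  intro a
  refine ⟨N * a, Nat.le_mul_of_pos_left a hN, ?_⟩
  obtain ⟨s, hsK, hcard, hs⟩ := key a
  have hnet : IsDynNetIn T G {q : X × X | dist q.1 q.2 < ε / 2} (N * a) s := by
    refine ⟨hsK.trans hKG, ?_⟩
    intro x hx y hy hxy
    rw [Function.onFun, Set.disjoint_left]
    intro z hzx hzy
    obtain ⟨j, hj, hd⟩ := hs x hx y hy hxy
    rw [mem_ball_dynEntourage] at hzx hzy
    have h1 : dist (T^[j] x) (T^[j] z) < ε / 2 := hzx j hj
    have h2 : dist (T^[j] y) (T^[j] z) < ε / 2 := hzy j hj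
    have := dist_triangle_right (T^[j] x) (T^[j] y) (T^[j] z)
    linarith
  have hle := ENat.toENNReal_mono hnet.card_le_netMaxcard
  refine le_trans (le_of_eq ?_) hle
  have hc : (0 : ℝ) < Fintype.card κ := by exact_mod_cast Fintype.card_pos
  have hN' : (N : ℝ) ≠ 0 := by positivity
  have e : ((Real.log (Fintype.card κ) / N : ℝ) : EReal) * ((N * a : ℕ) : EReal)
      = ((a * Real.log (Fintype.card κ) : ℝ) : EReal) := by
    rw [← EReal.coe_coe_eq_natCast, ← EReal.coe_mul]
    congr 1
    push_cast
    field_simp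
  rw [e, EReal.exp_coe, Real.exp_nat_mul, Real.exp_log hc, hcard]
  rw [ENNReal.ofReal_pow hc.le]
  simp

/-- The composition of the maps `g (w 0), …, g (w (k - 1))`. -/
def wordMap {X ι : Type*} (g : ι → X → X) : (k : ℕ) → (Fin k → ι) → X → X
  | 0, _ => id
  | k + 1, w => g (w 0) ∘ wordMap g k (Fin.tail w)

section Branches

variable {X ι : Type*} {T : X → X} {K O : Set X} {g : ι → X → X} {τ : ι → ℕ}

lemma wordMap_mapsTo (hK : ∀ i, MapsTo (g i) K K) :
    ∀ (k : ℕ) (w : Fin k → ι), MapsTo (wordMap g k w) K K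
  | 0, _ => mapsTo_id K
  | k + 1, w => (hK (w 0)).comp (wordMap_mapsTo hK k (Fin.tail w))

lemma wordMap_continuous [TopologicalSpace X] (hg : ∀ i, Continuous (g i)) :
    ∀ (k : ℕ) (w : Fin k → ι), Continuous (wordMap g k w)
  | 0, _ => continuous_id
  | k + 1, w => (hg (w 0)).comp (wordMap_continuous hg k (Fin.tail w))

lemma iterate_wordMap (hK : ∀ i, MapsTo (g i) K K) (hT : ∀ i, ∀ x ∈ K, T^[τ i] (g i x) = x) :
    ∀ (k : ℕ) (w : Fin k → ι), ∀ x ∈ K, T^[∑ j, τ (w j)] (wordMap g k w x) = x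
  | 0, _, x, _ => by simp [wordMap]
  | k + 1, w, x, hx => by
    rw [Fin.sum_univ_succ, add_comm, Function.iterate_add_apply, wordMap, Function.comp_apply,
      hT _ _ (wordMap_mapsTo hK k _ hx)]
    exact iterate_wordMap hK hT k (Fin.tail w) x hx

/-- A common first letter is stripped by applying the iterate of `T` that inverts it; at the first
difference the images of O are disjoint. -/
lemma wordMap_ne (hOK : O ⊆ K) (hO : ∀ i, MapsTo (g i) O O)
    (hT : ∀ i, ∀ x ∈ K, T^[τ i] (g i x) = x)
    (hdisj : ∀ i j, i ≠ j → ∀ x ∈ O, ∀ y ∈ O, g i x ≠ g j y) :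
    ∀ (k : ℕ) (w w' : Fin k → ι), w ≠ w' → ∀ x ∈ O, ∀ y ∈ O, wordMap g k w x ≠ wordMap g k w' y
  | 0, w, w', hw, _, _, _, _ => absurd (Subsingleton.elim w w') hw
  | k + 1, w, w', hw, x, hx, y, hy => by
    intro h
    simp only [wordMap, Function.comp_apply] at h
    have hx' := wordMap_mapsTo hO k (Fin.tail w) hx
    have hy' := wordMap_mapsTo hO k (Fin.tail w') hy
    by_cases h0 : w 0 = w' 0
    · refine wordMap_ne hOK hO hT hdisj k (Fin.tail w) (Fin.tail w') (fun ht => hw ?_) x hx y hy ?_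
      · rw [← Fin.cons_self_tail w, ← Fin.cons_self_tail w', h0, ht]
      · rw [← hT (w 0) _ (hOK hx'), h, h0, hT _ _ (hOK hy')]
    · exact hdisj _ _ h0 _ hx' _ hy' h

end Branches

/-- A lower bound for the entropy in terms of a system of inverse branches `g i` of `T^[τ i]` on a
compact set `K`, whose images of `O ⊆ K` are disjoint. -/
theorem log_le_coverEntropy_of_branches {X ι : Type*} [MetricSpace X] [Fintype ι]
    {T : X → X} {G K O : Set X} (hKc : IsCompact K) (hKne : K.Nonempty) (hKG : K ⊆ G) (hOK : O ⊆ K)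
    (g : ι → X → X) (τ : ι → ℕ) (hτ : ∀ i, 0 < τ i) (hg : ∀ i, Continuous (g i))
    (hK : ∀ i, MapsTo (g i) K K) (hO : ∀ i, MapsTo (g i) O O)
    (hT : ∀ i, ∀ x ∈ K, T^[τ i] (g i x) = x)
    (hdisj : ∀ i j, i ≠ j → ∀ x ∈ O, ∀ y ∈ O, g i x ≠ g j y)
    (v : X → X) (hv : Continuous v) (c : ℕ) (hvK : MapsTo v K O) (hTv : ∀ x ∈ K, T^[c] (v x) = x)
    {l : ℝ} (hl : 0 < l) (hsum : ∑ i, (l ^ τ i)⁻¹ = 1) :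
    (Real.log l : EReal) ≤ coverEntropy T G := by
  classical
  rw [← EReal.ge_of_forall_gt_iff_ge]
  intro a ha
  have ha : a < Real.log l := by exact_mod_cast ha
  obtain ⟨B, hB⟩ : ∃ B : ℕ, ∀ i, τ i ≤ B :=
    ⟨∑ i, τ i, fun i => Finset.single_le_sum (fun _ _ => Nat.zero_le _) (Finset.mem_univ i)⟩
  -- a number of letters so large that the polynomial loss is absorbed
  obtain ⟨k, hk1, hk⟩ : ∃ k : ℕ, 1 ≤ k ∧
      Real.log ((k * B + 1 : ℕ) : ℝ) + a * c ≤ k * (Real.log l - a) := by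
    set d := Real.log l - a with hd
    have hd0 : 0 < d := by linarith
    have hlin : Tendsto (fun k : ℕ => ((k * B + 1 : ℕ) : ℝ) / Real.exp (d / 2 * k)) atTop (𝓝 0) := by
      have h1 := (Real.tendsto_pow_mul_exp_neg_atTop_nhds_zero 1).comp
        ((tendsto_natCast_atTop_atTop (R := ℝ)).const_mul_atTop (half_pos hd0))
      have h2 := (Real.tendsto_pow_mul_exp_neg_atTop_nhds_zero 0).comp
        ((tendsto_natCast_atTop_atTop (R := ℝ)).const_mul_atTop (half_pos hd0))
      have := (h1.const_mul (B / (d / 2))).add h2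
      simp only [mul_zero, add_zero] at this
      refine this.congr fun k => ?_
      simp only [Function.comp_apply, pow_one, pow_zero, one_mul, Real.exp_neg]
      push_cast
      field_simp
    have h1 : ∀ᶠ k : ℕ in atTop, ((k * B + 1 : ℕ) : ℝ) / Real.exp (d / 2 * k) < 1 :=
      hlin.eventually (gt_mem_nhds one_pos)
    have h2 : ∀ᶠ k : ℕ in atTop, a * c ≤ d / 2 * k :=
      ((tendsto_natCast_atTop_atTop (R := ℝ)).const_mul_atTop (half_pos hd0)).eventually_ge_atTop _
    obtain ⟨k, h1, h2, h3⟩ := (h1.and (h2.and (eventually_ge_atTop 1))).exists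
    refine ⟨k, h3, ?_⟩
    rw [div_lt_one (Real.exp_pos _)] at h1
    have := Real.log_le_log (by positivity) h1.le
    rw [Real.log_exp] at this
    linarith
  -- a popular total time `N` of the words with `k` letters
  have hw1 : ∑ w : Fin k → ι, (l ^ (∑ j, τ (w j)))⁻¹ = 1 := by
    have := Fintype.sum_pow (fun i => (l ^ τ i)⁻¹) k
    rw [hsum, one_pow] at this
    rw [this]
    refine Finset.sum_congr rfl fun w _ => ?_
    rw [Finset.prod_inv_distrib, Finset.prod_pow_eq_pow_sum]
  obtain ⟨N, hN, hNcard⟩ : ∃ N ∈ Finset.range (k * B + 1),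
      1 / ((k * B + 1 : ℕ) : ℝ) ≤
        ∑ w : Fin k → ι with ∑ j, τ (w j) = N, (l ^ (∑ j, τ (w j)))⁻¹ := by
    refine Finset.exists_le_of_sum_le (by simp) ?_
    rw [Finset.sum_fiberwise_of_maps_to]
    · rw [hw1, Finset.sum_const, Finset.card_range, nsmul_eq_mul, mul_one_div, div_self]
      positivity
    · intro w _
      rw [Finset.mem_range, Nat.lt_succ_iff]
      calc ∑ j, τ (w j) ≤ ∑ _j : Fin k, B := Finset.sum_le_sum fun j _ => hB _
        _ = k * B := by simp
  set κ := {w : Fin k → ι // ∑ j, τ (w j) = N} with hκ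
  have hcard : 1 / ((k * B + 1 : ℕ) : ℝ) ≤ Fintype.card κ * (l ^ N)⁻¹ := by
    refine hNcard.trans (le_of_eq ?_)
    rw [Finset.sum_congr rfl (g := fun _ => (l ^ N)⁻¹), Finset.sum_const, nsmul_eq_mul,
      Fintype.card_subtype]
    intro w hw
    rw [(Finset.mem_filter.1 hw).2]
  have hcpos : 0 < Fintype.card κ := by
    by_contra h0
    have : Fintype.card κ = 0 := by omega
    rw [this, Nat.cast_zero, zero_mul] at hcard
    have : 0 < 1 / ((k * B + 1 : ℕ) : ℝ) := by positivity
    linarith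
  have : Nonempty κ := Fintype.card_pos_iff.1 hcpos
  have hkN : k ≤ N := by
    obtain ⟨w, hw⟩ := this
    calc k = ∑ _j : Fin k, 1 := by simp
      _ ≤ ∑ j, τ (w j) := Finset.sum_le_sum fun j _ => hτ _
      _ = N := hw
  let h : κ → X → X := fun w => wordMap g k w.1 ∘ v
  have hcont : ∀ w, Continuous (h w) := fun w => (wordMap_continuous hg k w.1).comp hv
  -- Precomposition with v pushes the compact set K into O, where different words have different
  -- values. The distance of two words therefore attains a positive minimum on K × K.
  have hsep : ∀ q : κ × κ, ∀ᶠ ε : ℝ in 𝓝[>] 0, q.1 ≠ q.2 →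
      ∀ x ∈ K, ∀ y ∈ K, ε ≤ dist (h q.1 x) (h q.2 y) := by
    rintro ⟨w, w'⟩
    by_cases hww : w = w'
    · simp [hww]
    obtain ⟨z, hz, hmin⟩ := (hKc.prod hKc).exists_isMinOn (hKne.prod hKne)
      (f := fun z : X × X => dist (h w z.1) (h w' z.2))
      (((hcont w).comp continuous_fst).dist ((hcont w').comp continuous_snd)).continuousOn
    have hpos : 0 < dist (h w z.1) (h w' z.2) := dist_pos.2 <|
      wordMap_ne hOK hO hT hdisj k w.1 w'.1 (fun e => hww (Subtype.ext e)) _ (hvK hz.1) _ (hvK hz.2)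
    filter_upwards [Ioo_mem_nhdsGT hpos] with ε hε _ x hx y hy
    exact hε.2.le.trans (hmin (mk_mem_prod hx hy))
  obtain ⟨ε, hε, hε0⟩ := ((eventually_all.2 hsep).and self_mem_nhdsWithin).exists
  have main := log_card_div_le_coverEntropy (T := T) (G := G) h (N := N + c) (by omega) hKG hKne
    (fun w x hx => wordMap_mapsTo hK k w.1 (hOK (hvK hx)))
    (fun w x hx => by
      have := iterate_wordMap hK hT k w.1 (v x) (hOK (hvK hx))
      rw [w.2] at this
      rw [add_comm, Function.iterate_add_apply]
      exact (congrArg _ this).trans (hTv x hx))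
    hε0 (fun i j hij => hε (i, j) hij)
  refine le_trans ?_ main
  rw [EReal.coe_le_coe_iff]
  have hNc : (0 : ℝ) < ((N + c : ℕ) : ℝ) := by
    have : 0 < N + c := by omega
    exact_mod_cast this
  rw [le_div_iff₀ hNc]
  have h1 := Real.log_le_log (by positivity) hcard
  rw [Real.log_mul (by positivity) (by positivity), Real.log_inv, Real.log_pow, one_div,
    Real.log_inv] at h1
  -- As N ≥ k, the gain N (log l - a) covers both losses: the pigeonhole factor k B + 1 and the
  -- extra time c spent on v.
  have h2 : (k : ℝ) * (Real.log l - a) ≤ N * (Real.log l - a) :=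
    mul_le_mul_of_nonneg_right (by exact_mod_cast hkN) (by linarith)
  push_cast at hk h1 ⊢
  nlinarith

end Dynamics

/-! ### Upper bounds for the entropy from splitting numbers of arcs -/

lemma exists_finset_mesh (u v : ℝ) {δ : ℝ} (hδ : 0 < δ) : ∃ M : Finset ℝ, ∀ s t, u ≤ s → s ≤ t →
    t ≤ v → (∀ p ∈ M, ¬(s < p ∧ p < t)) → t - s ≤ δ := by
  obtain ⟨N, hN⟩ := exists_nat_gt ((v - u) / δ)
  rw [div_lt_iff₀ hδ] at hN
  refine ⟨(Finset.range (N + 1)).image fun i : ℕ => u + i * δ, fun s t hs _ ht hM => ?_⟩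
  by_contra! hlt
  set i := ⌊(s - u) / δ⌋₊ with hi
  have h0 : 0 ≤ (s - u) / δ := div_nonneg (by linarith) hδ.le
  have h1 : (i : ℝ) * δ ≤ s - u := (le_div_iff₀ hδ).1 (Nat.floor_le h0)
  have h2 : s - u < (i + 1) * δ := (div_lt_iff₀ hδ).1 (Nat.lt_floor_add_one _)
  refine hM (u + ((i + 1 : ℕ) : ℝ) * δ) (Finset.mem_image.2 ⟨i + 1, ?_, rfl⟩) ?_
  · rw [Finset.mem_range]
    have : (i : ℝ) < N := by
      by_contra! h
      have := mul_le_mul_of_nonneg_right h hδ.le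
      linarith
    have : i < N := by exact_mod_cast this
    omega
  · push_cast
    constructor <;> linarith

/-- A sequence dominated by a sum of delayed copies of itself grows at most like `x ^ n`, if the
total weight of the delays is less than one. -/
lemma exists_le_mul_pow_of_le_sum_delay {a : ℕ → ℝ} {x D : ℝ} (hx : 0 < x) (ha0 : a 0 = 0)
    (hD : 0 ≤ D) (l : List ℕ) (hl : ∀ k ∈ l, 0 < k) (hs : (l.map fun k => (x ^ k)⁻¹).sum < 1)
    (hrec : ∀ n, a n ≤ (l.map fun k => a (n - k)).sum + D * x ^ n) :
    ∃ C, 0 ≤ C ∧ ∀ n, a n ≤ C * x ^ n := by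
  set σ := (l.map fun k => (x ^ k)⁻¹).sum with hσ
  have hC : 0 ≤ D / (1 - σ) := div_nonneg hD (by linarith)
  refine ⟨D / (1 - σ), hC, fun n => ?_⟩
  induction n using Nat.strong_induction_on with
  | _ n ih =>
    have h1 : (l.map fun k => a (n - k)).sum ≤
        (l.map fun k => D / (1 - σ) * x ^ n * (x ^ k)⁻¹).sum := by
      refine List.sum_le_sum fun k hk => ?_
      rcases le_or_gt k n with hkn | hkn
      · refine (ih (n - k) (by have := hl k hk; omega)).trans (le_of_eq ?_)
        rw [mul_assoc, pow_sub₀ _ hx.ne' hkn]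
      · rw [Nat.sub_eq_zero_of_le hkn.le, ha0]
        positivity
    rw [List.sum_map_mul_left, ← hσ] at h1
    have h2 := hrec n
    have h3 : D = D / (1 - σ) * (1 - σ) := by
      rw [div_mul_cancel₀]
      linarith
    have h4 : D * x ^ n = D / (1 - σ) * (1 - σ) * x ^ n := by rw [← h3]
    calc a n ≤ _ := h2
      _ ≤ D / (1 - σ) * x ^ n * σ + D / (1 - σ) * (1 - σ) * x ^ n := by rw [← h4]; gcongr
      _ = D / (1 - σ) * x ^ n := by ring

namespace Dynamics

/-- Along the arc `γ` over `[u, v]`, any two parameters not separated by a point of `P` have orbits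
which stay `ε`-close up to time `n`. -/
def Splits {X : Type*} [PseudoMetricSpace X] (T : X → X) (ε : ℝ) (γ : ℝ → X) (u v : ℝ) (n : ℕ)
    (P : Finset ℝ) : Prop :=
  ∀ s t, u ≤ s → s ≤ t → t ≤ v → (∀ p ∈ P, ¬(s < p ∧ p < t)) →
    ∀ k < n, dist (T^[k] (γ s)) (T^[k] (γ t)) ≤ ε

/-- The minimal number of points which split the arc `γ` over `[u, v]` into pieces of `ε`-close
orbits up to time `n`. -/
noncomputable def splitNum {X : Type*} [PseudoMetricSpace X] (T : X → X) (ε : ℝ) (γ : ℝ → X)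
    (u v : ℝ) (n : ℕ) : ℕ :=
  sInf {m | ∃ P : Finset ℝ, P.card = m ∧ Splits T ε γ u v n P}

section SplitNum

variable {X : Type*} [PseudoMetricSpace X] {T : X → X} {ε : ℝ} {γ γ' : ℝ → X} {u v w u' v' : ℝ}
  {n : ℕ}

lemma Splits.splitNum_le {P : Finset ℝ} (h : Splits T ε γ u v n P) :
    splitNum T ε γ u v n ≤ P.card :=
  Nat.sInf_le ⟨P, rfl, h⟩

lemma splitNum_zero : splitNum T ε γ u v 0 = 0 :=
  Nat.le_zero.1 (Splits.splitNum_le (P := ∅) fun _ _ _ _ _ _ k hk => absurd hk (Nat.not_lt_zero k))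

lemma splitNum_self (hε : 0 ≤ ε) : splitNum T ε γ u u n = 0 :=
  Nat.le_zero.1 <| Splits.splitNum_le (P := ∅) fun s t hs hst ht _ k _ => by
    rw [le_antisymm hst (ht.trans hs), dist_self]
    exact hε

lemma exists_splits (hT : Continuous T) (hγ : Continuous γ) (hε : 0 < ε) (u v : ℝ) (n : ℕ) :
    ∃ P, Splits T ε γ u v n P := by
  classical
  induction n with
  | zero => exact ⟨∅, fun _ _ _ _ _ _ k hk => absurd hk (Nat.not_lt_zero k)⟩
  | succ n ih =>
    obtain ⟨P, hP⟩ := ih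
    have huc := (isCompact_Icc (a := u) (b := v)).uniformContinuousOn_of_continuous
      ((hT.iterate n).comp hγ).continuousOn
    rw [Metric.uniformContinuousOn_iff] at huc
    obtain ⟨δ, hδ, huc⟩ := huc ε hε
    obtain ⟨M, hM⟩ := exists_finset_mesh u v (half_pos hδ)
    refine ⟨P ∪ M, fun s t hs hst ht hp k hk => ?_⟩
    rcases Nat.lt_succ_iff_lt_or_eq.1 hk with hk | rfl
    · exact hP s t hs hst ht (fun p h => hp p (Finset.mem_union_left _ h)) k hk
    · have := hM s t hs hst ht (fun p h => hp p (Finset.mem_union_right _ h))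
      refine (huc s ⟨hs, hst.trans ht⟩ t ⟨hs.trans hst, ht⟩ ?_).le
      rw [dist_comm, Real.dist_eq, abs_of_nonneg] <;> linarith

/-- The infimum is attained only because some splitting set exists; for an empty set of naturals it
would be a meaningless 0. -/
lemma exists_splits_card (hT : Continuous T) (hγ : Continuous γ) (hε : 0 < ε) (u v : ℝ) (n : ℕ) :
    ∃ P, P.card = splitNum T ε γ u v n ∧ Splits T ε γ u v n P :=
  Nat.sInf_mem (s := {m | ∃ P : Finset ℝ, P.card = m ∧ Splits T ε γ u v n P})
    ((exists_splits hT hγ hε u v n).imp' Finset.card fun P hP => ⟨P, rfl, hP⟩)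

lemma splitNum_le_add (hT : Continuous T) (hγ : Continuous γ) (hε : 0 < ε) (w : ℝ) :
    splitNum T ε γ u v n ≤ splitNum T ε γ u w n + splitNum T ε γ w v n + 1 := by
  classical
  obtain ⟨P, hc, hP⟩ := exists_splits_card hT hγ hε u w n
  obtain ⟨Q, hd, hQ⟩ := exists_splits_card hT hγ hε w v n
  have : Splits T ε γ u v n (insert w (P ∪ Q)) := by
    intro s t hs hst ht hp
    have hw := hp w (Finset.mem_insert_self _ _)
    rcases le_or_gt t w with h | h
    · exact hP s t hs hst h fun p hpP => hp p (by simp [hpP])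
    · exact hQ s t (by by_contra! h'; exact hw ⟨h', h⟩) hst ht fun p hpQ => hp p (by simp [hpQ])
  calc splitNum T ε γ u v n ≤ (insert w (P ∪ Q)).card := this.splitNum_le
    _ ≤ (P ∪ Q).card + 1 := Finset.card_insert_le _ _
    _ ≤ P.card + Q.card + 1 := by gcongr; exact Finset.card_union_le _ _
    _ = _ := by rw [hc, hd]

/-- If `T` maps the arc `γ` over `[u, v]` affinely into the arc `γ'` over `[u', v']`, then the
splitting number grows by at most a constant. -/
lemma splitNum_le_of_affine (hT : Continuous T) (hγ' : Continuous γ') (hε : 0 < ε)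
    (hγ : ∀ s t, dist (γ s) (γ t) ≤ |s - t|) {M : Finset ℝ}
    (hM : ∀ s t, u ≤ s → s ≤ t → t ≤ v → (∀ p ∈ M, ¬(s < p ∧ p < t)) → t - s ≤ ε)
    {a c : ℝ} (hTγ : ∀ x, u ≤ x → x ≤ v → T (γ x) = γ' (a * x + c))
    (hmap : ∀ x, u ≤ x → x ≤ v → u' ≤ a * x + c ∧ a * x + c ≤ v') :
    splitNum T ε γ u v n ≤ splitNum T ε γ' u' v' (n - 1) + M.card := by
  classical
  -- Preimages of the splitting points of the image arc handle the times from 1 on; the mesh M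
  -- handles time 0.
  obtain ⟨P, hc, hP⟩ := exists_splits_card hT hγ' hε u' v' (n - 1)
  have : Splits T ε γ u v n (P.image (fun p => (p - c) / a) ∪ M) := by
    intro s t hs hst ht hp k hk
    have hsv := hst.trans ht
    have hut := hs.trans hst
    rcases k with _ | k
    · refine (hγ s t).trans ?_
      rw [abs_sub_comm, abs_of_nonneg (by linarith)]
      exact hM s t hs hst ht fun p h => hp p (Finset.mem_union_right _ h)
    · have hk' : k < n - 1 := by omega
      rw [Function.iterate_succ_apply, Function.iterate_succ_apply, hTγ s hs hsv, hTγ t hut ht]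
      have hp' : ∀ p ∈ P, ¬(s < (p - c) / a ∧ (p - c) / a < t) := fun p h =>
        hp _ (Finset.mem_union_left _ (Finset.mem_image_of_mem _ h))
      rcases lt_trichotomy a 0 with ha | ha | ha
      · rw [dist_comm]
        refine hP _ _ (hmap t hut ht).1 (by nlinarith) (hmap s hs hsv).2 (fun p h h' => ?_) k hk'
        refine hp' p h ⟨?_, ?_⟩
        · rw [lt_div_iff_of_neg ha]; linarith [h'.2]
        · rw [div_lt_iff_of_neg ha]; linarith [h'.1]
      -- For a = 0 the points (p - c) / a are junk, but the image arc is a single point and needs no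
      -- splitting.
      · simp [ha, hε.le]
      · refine hP _ _ (hmap s hs hsv).1 (by nlinarith) (hmap t hut ht).2 (fun p h h' => ?_) k hk'
        refine hp' p h ⟨?_, ?_⟩
        · rw [lt_div_iff₀ ha]; linarith [h'.1]
        · rw [div_lt_iff₀ ha]; linarith [h'.2]
  calc splitNum T ε γ u v n ≤ _ := this.splitNum_le
    _ ≤ (P.image fun p => (p - c) / a).card + M.card :=
      Finset.card_union_le (P.image fun p => (p - c) / a) M
    _ ≤ P.card + M.card := Nat.add_le_add_right Finset.card_image_le _
    _ = _ := by rw [hc]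

/-- Parameters are classified by how many splitting points lie at or to the left of them. Two
parameters of one class have no splitting point between them, so one representative per class gives
a cover with at most one element more than there are splitting points. -/
lemma coverMincard_image_Icc_le (hT : Continuous T) (hγ : Continuous γ) (hε : 0 < ε)
    {U : SetRel X X} (hU : ∀ x y, dist x y ≤ ε → (x, y) ∈ U) :
    coverMincard T (γ '' Icc u v) U n ≤ ((splitNum T ε γ u v n + 1 : ℕ) : ℕ∞) := by
  classical
  obtain ⟨P, hc, hP⟩ := exists_splits_card hT hγ hε u v n
  let N : ℝ → ℕ := fun s => (P.filter (· ≤ s)).card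
  let rep : ℕ → ℝ := fun i => if h : ∃ s ∈ Icc u v, N s = i then h.choose else 0
  have hcov : IsDynCoverOf T (γ '' Icc u v) U n
      ((Finset.range (P.card + 1)).image fun i => γ (rep i) : Finset X) := by
    rintro _ ⟨s, hs, rfl⟩
    have hex : ∃ r ∈ Icc u v, N r = N s := ⟨s, hs, rfl⟩
    have hrep : rep (N s) = hex.choose := dif_pos hex
    obtain ⟨hr, hNr⟩ := hex.choose_spec
    rw [← hrep] at hr hNr
    refine ⟨γ (rep (N s)), ?_, ?_⟩
    · simp only [Finset.coe_image, Finset.coe_range, mem_image, mem_Iio]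
      exact ⟨N s, Nat.lt_succ_iff.2 (Finset.card_filter_le _ _), rfl⟩
    · have aux : ∀ x y, x ≤ y → N x = N y → ∀ p ∈ P, ¬(x < p ∧ p < y) := by
        intro x y hxy hN p hp hpxy
        have hsub : P.filter (· ≤ x) ⊆ P.filter (· ≤ y) :=
          Finset.monotone_filter_right P fun z _ hz => le_trans hz hxy
        have heq := Finset.eq_of_subset_of_card_le hsub hN.ge
        have : p ∈ P.filter (· ≤ x) := by
          rw [heq]; exact Finset.mem_filter.2 ⟨hp, hpxy.2.le⟩
        exact absurd (Finset.mem_filter.1 this).2 (not_le.2 hpxy.1)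
      refine mem_dynEntourage.2 fun k hk => hU _ _ ?_
      rcases le_total s (rep (N s)) with hle | hle
      · exact hP _ _ hs.1 hle hr.2 (aux _ _ hle hNr.symm) k hk
      · rw [dist_comm]
        exact hP _ _ hr.1 hle hs.2 (aux _ _ hle hNr) k hk
  refine hcov.coverMincard_le_card.trans ?_
  have := Finset.card_image_le (s := Finset.range (P.card + 1)) (f := fun i => γ (rep i))
  rw [Finset.card_range] at this
  rw [← hc]
  exact_mod_cast this

theorem coverEntropy_image_Icc_le (hT : Continuous T) (hγ : Continuous γ) {x : ℝ} (hx : 1 ≤ x)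
    (h : ∀ ε > 0, ∃ C, ∀ n, (splitNum T ε γ u v n : ℝ) ≤ C * x ^ n) :
    coverEntropy T (γ '' Icc u v) ≤ (Real.log x : EReal) := by
  refine iSup₂_le fun U hU => ?_
  obtain ⟨ε, hε, hεU⟩ := Metric.mem_uniformity_dist.1 hU
  obtain ⟨C, hC⟩ := h (ε / 2) (half_pos hε)
  have hx0 : 0 < x := by linarith
  rw [← ENNReal.log_ofReal_of_pos hx0, ← ExpGrowth.expGrowthSup_pow]
  refine ExpGrowth.expGrowthSup_le_of_eventually_le (b := ENNReal.ofReal (C + 1))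
    ENNReal.ofReal_ne_top (Eventually.of_forall fun n => ?_)
  have h1 := ENat.toENNReal_mono <| coverMincard_image_Icc_le (u := u) (v := v) (n := n) hT hγ
    (half_pos hε) (U := U) fun a b hab => hεU (by linarith)
  refine h1.trans ?_
  have hp : 1 ≤ x ^ n := one_le_pow₀ hx
  rw [← ENNReal.ofReal_pow hx0.le, ← ENNReal.ofReal_mul']
  · rw [ENat.toENNReal_coe, ← ENNReal.ofReal_natCast]
    apply ENNReal.ofReal_le_ofReal
    push_cast
    nlinarith [hC n]
  · positivity

end SplitNum

end Dynamics

/-! ### Weight equations and the five polynomials -/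

namespace PWLinear

/-- The sum of the weights `x ^ (-k)` over the return times `k ∈ l`. -/
noncomputable def weight (l : List ℕ) (x : ℝ) : ℝ := (l.map fun k => (x ^ k)⁻¹).sum

@[simp] lemma weight_nil (x : ℝ) : weight [] x = 0 := rfl

@[simp] lemma weight_cons (k : ℕ) (l : List ℕ) (x : ℝ) :
    weight (k :: l) x = (x ^ k)⁻¹ + weight l x := by
  simp [weight]

lemma weight_antitone (l : List ℕ) {x y : ℝ} (hx : 0 < x) (hxy : x ≤ y) :
    weight l y ≤ weight l x :=
  List.sum_le_sum fun k _ => by gcongr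

lemma weight_lt_weight {l : List ℕ} (hl : ∀ k ∈ l, 0 < k) (hne : l ≠ []) {x y : ℝ} (hx : 0 < x)
    (hxy : x < y) : weight l y < weight l x := by
  obtain ⟨k, l, rfl⟩ := List.exists_cons_of_ne_nil hne
  rw [weight_cons, weight_cons]
  have hk : k ≠ 0 := (hl k (by simp)).ne'
  have := weight_antitone l hx hxy.le
  have h2 : (y ^ k)⁻¹ < (x ^ k)⁻¹ := by gcongr
  linarith

lemma weight_continuousOn (l : List ℕ) : ContinuousOn (weight l) (Ioi 0) := by
  induction l with
  | nil => simpa [funext weight_nil] using continuousOn_const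
  | cons k l ih =>
    refine ContinuousOn.congr (ContinuousOn.add (ContinuousOn.inv₀ (continuousOn_pow k) ?_) ih)
      fun x _ => weight_cons k l x
    intro x hx
    exact (pow_pos hx k).ne'

/-- Intermediate value theorem: the weight is the number of times, at least 2, at x = 1, and at most
1 when x equals that number. -/
lemma exists_weight_eq_one {l : List ℕ} (hl : ∀ k ∈ l, 0 < k) (h2 : 2 ≤ l.length) :
    ∃ x, 1 < x ∧ weight l x = 1 := by
  have h1 : weight l 1 = l.length := by simp [weight]
  have h2' : (2 : ℝ) ≤ l.length := by exact_mod_cast h2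
  have hlen : weight l l.length ≤ 1 := by
    have : weight l l.length ≤ l.length • (l.length : ℝ)⁻¹ := by
      refine (List.sum_le_card_nsmul _ (l.length : ℝ)⁻¹ ?_).trans (by simp)
      intro z hz
      obtain ⟨k, hk, rfl⟩ := List.mem_map.1 hz
      gcongr
      exact le_self_pow₀ (by linarith) (hl k hk).ne'
    rwa [nsmul_eq_mul, mul_inv_cancel₀ (by linarith)] at this
  obtain ⟨x, hx, hx1⟩ := intermediate_value_Icc' (a := (1 : ℝ)) (b := l.length) (by linarith)
    ((weight_continuousOn l).mono fun z hz => lt_of_lt_of_le one_pos hz.1)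
    (show (1 : ℝ) ∈ _ from ⟨hlen, by rw [h1]; linarith⟩)
  refine ⟨x, lt_of_le_of_ne hx.1 ?_, hx1⟩
  rintro rfl
  rw [h1] at hx1
  linarith

/-- The number `x > 1` at which the weights of the return times `l` sum to one. -/
def IsWeightRoot (l : List ℕ) (x : ℝ) : Prop := 1 < x ∧ weight l x = 1

/-- Weights decrease in x, so a larger weight function reaches the value 1 further to the right. -/
lemma IsWeightRoot.lt {l l' : List ℕ} {x x' : ℝ} (h : IsWeightRoot l x) (h' : IsWeightRoot l' x')
    (hlt : ∀ z, 1 < z → weight l z < weight l' z) : x < x' := by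
  by_contra! hle
  have h1 := hlt x h.1
  have h2 := weight_antitone l' (zero_lt_one.trans h'.1) hle
  rw [h.2] at h1
  rw [h'.2] at h2
  linarith

lemma IsWeightRoot.tendsto_one {l : ℕ → List ℕ} {x : ℕ → ℝ} (h : ∀ n, IsWeightRoot (l n) (x n))
    (hl : ∀ z, 1 < z → ∀ᶠ n in atTop, weight (l n) z < 1) : Tendsto x atTop (𝓝 1) := by
  rw [tendsto_order]
  refine ⟨fun a ha => Eventually.of_forall fun n => ha.trans (h n).1, fun a ha => ?_⟩
  filter_upwards [hl a ha] with n hn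
  by_contra! hle
  have := weight_antitone (l n) (zero_lt_one.trans ha) hle
  rw [(h n).2] at this
  linarith

lemma IsWeightRoot.isUniquePosRoot {l : List ℕ} (hl : ∀ k ∈ l, 0 < k) (hne : l ≠ []) {x : ℝ}
    (h : IsWeightRoot l x) {P : Polynomial ℝ} (hP : ∀ y, 0 < y → (P.IsRoot y ↔ weight l y = 1)) :
    IsUniquePosRoot P x := by
  have hx : 0 < x := zero_lt_one.trans h.1
  refine ⟨⟨hx, (hP x hx).2 h.2⟩, fun y hy hy' => ?_⟩
  have hw := (hP y hy).1 hy'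
  rcases lt_trichotomy y x with hlt | heq | hlt
  · have := weight_lt_weight hl hne hy hlt
    rw [hw, h.2] at this
    exact absurd this (lt_irrefl _)
  · exact heq
  · have := weight_lt_weight hl hne hx hlt
    rw [hw, h.2] at this
    exact absurd this (lt_irrefl _)

def timesAlpha (n : ℕ) : List ℕ := [3, 7 + 3 * n]

def timesBeta (n : ℕ) : List ℕ := [3, 4 + 3 * n, 7 + 3 * n, 7 + 3 * n]

def timesGamma (n : ℕ) : List ℕ := [3, 7 + 3 * n, 7 + 3 * n, 10 + 3 * n]

def timesDelta (n : ℕ) : List ℕ := [3, 7 + 3 * n, 7 + 3 * n]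

def timesPhi (n : ℕ) : List ℕ := [3, 7 + 3 * n, 10 + 3 * n]

lemma pow_level_seven (x : ℝ) (n : ℕ) : x ^ (7 + 3 * n) = x ^ (4 + 3 * n) * x ^ 3 := by
  rw [← pow_add]; congr 1; ring

lemma pow_level_ten (x : ℝ) (n : ℕ) : x ^ (10 + 3 * n) = x ^ (4 + 3 * n) * x ^ 3 * x ^ 3 := by
  rw [← pow_add, ← pow_add]; congr 1; ring

/-- Multiplying the weight equation by the highest power of x occurring in it gives the polynomial
equation. The four analogues below work the same way. -/
lemma isRoot_polyAlpha (n : ℕ) {x : ℝ} (hx : 0 < x) :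
    (polyAlpha n).IsRoot x ↔ weight (timesAlpha n) x = 1 := by
  simp only [polyAlpha, timesAlpha, Polynomial.IsRoot.def, Polynomial.eval_sub,
    Polynomial.eval_pow, Polynomial.eval_X, Polynomial.eval_one, weight_cons, weight_nil,
    pow_level_seven]
  have hA : 0 < x ^ (4 + 3 * n) := by positivity
  have hc : 0 < x ^ 3 := by positivity
  generalize x ^ (4 + 3 * n) = A at *
  generalize x ^ 3 = c at *
  field_simp
  constructor <;> intro h <;> linarith

lemma isRoot_polyBeta (n : ℕ) {x : ℝ} (hx : 0 < x) :
    (polyBeta n).IsRoot x ↔ weight (timesBeta n) x = 1 := by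
  simp only [polyBeta, timesBeta, Polynomial.IsRoot.def, Polynomial.eval_sub,
    Polynomial.eval_pow, Polynomial.eval_X, Polynomial.eval_ofNat, weight_cons, weight_nil,
    pow_level_seven]
  have hA : 0 < x ^ (4 + 3 * n) := by positivity
  have hc : 0 < x ^ 3 := by positivity
  generalize x ^ (4 + 3 * n) = A at *
  generalize x ^ 3 = c at *
  field_simp
  constructor <;> intro h <;> linarith

lemma isRoot_polyGamma (n : ℕ) {x : ℝ} (hx : 0 < x) :
    (polyGamma n).IsRoot x ↔ weight (timesGamma n) x = 1 := by
  simp only [polyGamma, timesGamma, Polynomial.IsRoot.def, Polynomial.eval_sub,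
    Polynomial.eval_mul, Polynomial.eval_pow, Polynomial.eval_X, Polynomial.eval_one,
    Polynomial.eval_ofNat, weight_cons, weight_nil, pow_level_seven, pow_level_ten]
  have hA : 0 < x ^ (4 + 3 * n) := by positivity
  have hc : 0 < x ^ 3 := by positivity
  generalize x ^ (4 + 3 * n) = A at *
  generalize x ^ 3 = c at *
  field_simp
  constructor <;> intro h <;> linarith

lemma isRoot_polyDelta (n : ℕ) {x : ℝ} (hx : 0 < x) :
    (polyDelta n).IsRoot x ↔ weight (timesDelta n) x = 1 := by
  simp only [polyDelta, timesDelta, Polynomial.IsRoot.def, Polynomial.eval_sub,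
    Polynomial.eval_pow, Polynomial.eval_X, Polynomial.eval_ofNat, weight_cons, weight_nil,
    pow_level_seven]
  have hA : 0 < x ^ (4 + 3 * n) := by positivity
  have hc : 0 < x ^ 3 := by positivity
  generalize x ^ (4 + 3 * n) = A at *
  generalize x ^ 3 = c at *
  field_simp
  constructor <;> intro h <;> linarith

lemma isRoot_polyPhi (n : ℕ) {x : ℝ} (hx : 0 < x) :
    (polyPhi n).IsRoot x ↔ weight (timesPhi n) x = 1 := by
  simp only [polyPhi, timesPhi, Polynomial.IsRoot.def, Polynomial.eval_sub,
    Polynomial.eval_pow, Polynomial.eval_X, Polynomial.eval_one, weight_cons, weight_nil,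
    pow_level_seven, pow_level_ten]
  have hA : 0 < x ^ (4 + 3 * n) := by positivity
  have hc : 0 < x ^ 3 := by positivity
  generalize x ^ (4 + 3 * n) = A at *
  generalize x ^ 3 = c at *
  field_simp
  constructor <;> intro h <;> linarith

lemma inv_pow_lt {x : ℝ} (hx : 1 < x) {j k : ℕ} (hjk : j < k) : (x ^ k)⁻¹ < (x ^ j)⁻¹ := by
  gcongr

/-- As n grows only the term of the time 3 survives, and it is less than 1. -/
lemma eventually_weight_lt_one {x : ℝ} (hx : 1 < x) (c : List ℕ) :
    ∀ᶠ n : ℕ in atTop, weight (3 :: c.map fun k => k + 3 * n) x < 1 := by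
  have hx0 : 0 < x := by linarith
  have hlim : Tendsto (fun n : ℕ => weight (c.map fun k => k + 3 * n) x) atTop (𝓝 0) := by
    induction c with
    | nil => simp
    | cons k c ih =>
      simp only [List.map_cons, weight_cons]
      rw [← add_zero (0 : ℝ)]
      refine Tendsto.add ?_ ih
      have h1 : Tendsto (fun n : ℕ => k + 3 * n) atTop atTop :=
        tendsto_atTop_mono (fun n => show n ≤ k + 3 * n by omega) tendsto_id
      exact ((tendsto_pow_atTop_atTop_of_one_lt hx).comp h1).inv_tendsto_atTop
  have h3 : (x ^ 3)⁻¹ < 1 := inv_lt_one_of_one_lt₀ (one_lt_pow₀ hx (by norm_num))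
  filter_upwards [hlim.eventually (gt_mem_nhds (show 0 < 1 - (x ^ 3)⁻¹ by linarith))] with n hn
  rw [weight_cons]
  linarith

open Dynamics

/-! ### The five arcs of the graph, parametrised by the first coordinate -/

def arcA (b x : ℝ) : ℝ × ℝ := (x, x + b + 1)

def arcB (_b x : ℝ) : ℝ × ℝ := (x, -1)

def arcC (b x : ℝ) : ℝ × ℝ := (x, b - 1 - x)

def arcD (b x : ℝ) : ℝ × ℝ := (x, 2 * b - 1)

def arcE (b x : ℝ) : ℝ × ℝ := (x, x + b - 1)

lemma continuous_F (a b : ℝ) : Continuous (F a b) := by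
  unfold F; fun_prop

lemma continuous_arcA (b : ℝ) : Continuous (arcA b) := by unfold arcA; fun_prop

lemma continuous_arcB (b : ℝ) : Continuous (arcB b) := by unfold arcB; fun_prop

lemma continuous_arcC (b : ℝ) : Continuous (arcC b) := by unfold arcC; fun_prop

lemma continuous_arcD (b : ℝ) : Continuous (arcD b) := by unfold arcD; fun_prop

lemma continuous_arcE (b : ℝ) : Continuous (arcE b) := by unfold arcE; fun_prop

lemma dist_arcA (b s t : ℝ) : dist (arcA b s) (arcA b t) ≤ |s - t| := by
  simp [arcA, Prod.dist_eq, Real.dist_eq]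

lemma dist_arcB (b s t : ℝ) : dist (arcB b s) (arcB b t) ≤ |s - t| := by
  simp [arcB, Prod.dist_eq, Real.dist_eq]

lemma dist_arcC (b s t : ℝ) : dist (arcC b s) (arcC b t) ≤ |s - t| := by
  have : b - 1 - s - (b - 1 - t) = -(s - t) := by ring
  simp only [arcC, Prod.dist_eq, Real.dist_eq, this, abs_neg, max_self, le_refl]

lemma dist_arcD (b s t : ℝ) : dist (arcD b s) (arcD b t) ≤ |s - t| := by
  simp [arcD, Prod.dist_eq, Real.dist_eq]

lemma dist_arcE (b s t : ℝ) : dist (arcE b s) (arcE b t) ≤ |s - t| := by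
  simp [arcE, Prod.dist_eq, Real.dist_eq]

section Images

variable {b x : ℝ}

lemma F_arcA_of_nonneg (hb : 4 < b) (hx : 0 ≤ x) :
    F (-1) b (arcA b x) = arcA b (-b - 2) := by
  simp only [F, arcA]
  rw [abs_of_nonneg hx, abs_of_nonneg (by linarith)]
  ext <;> simp <;> ring

lemma F_arcA_of_mem (hx : -b - 1 ≤ x) (hx' : x ≤ 0) :
    F (-1) b (arcA b x) = arcB b (-2 * x - b - 2) := by
  simp only [F, arcA, arcB]
  rw [abs_of_nonpos hx', abs_of_nonneg (by linarith)]
  ext <;> simp <;> ring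

lemma F_arcA_of_le (hb : 4 < b) (hx : x ≤ -b - 1) :
    F (-1) b (arcA b x) = arcC b (-2 * x - b - 2) := by
  simp only [F, arcA, arcC]
  rw [abs_of_nonpos (by linarith : x ≤ 0), abs_of_nonpos (by linarith)]
  ext <;> simp <;> ring

lemma F_arcB_of_nonpos (hx : x ≤ 0) : F (-1) b (arcB b x) = arcC b (-x) := by
  simp only [F, arcB, arcC]
  rw [abs_of_nonpos hx]
  ext <;> simp <;> ring

lemma F_arcB_of_nonneg (hx : 0 ≤ x) : F (-1) b (arcB b x) = arcE b x := by
  simp only [F, arcB, arcE]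
  rw [abs_of_nonneg hx]
  ext <;> simp <;> ring

lemma F_arcC_of_le (hx : 0 ≤ x) (hx' : x ≤ b - 1) :
    F (-1) b (arcC b x) = arcA b (2 * x - b) := by
  simp only [F, arcC, arcA]
  rw [abs_of_nonneg hx, abs_of_nonneg (by linarith)]
  ext <;> simp <;> ring

lemma F_arcC_of_ge (hb : 4 < b) (hx : b - 1 ≤ x) :
    F (-1) b (arcC b x) = arcD b (2 * x - b) := by
  simp only [F, arcC, arcD]
  rw [abs_of_nonneg (by linarith : 0 ≤ x), abs_of_nonpos (by linarith)]
  ext <;> simp <;> ring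

lemma F_arcD (hb : 4 < b) (hx : 0 ≤ x) :
    F (-1) b (arcD b x) = arcA b (x - 2 * b) := by
  simp only [F, arcD, arcA]
  rw [abs_of_nonneg hx, abs_of_nonneg (by linarith)]
  ext <;> simp <;> ring

lemma F_arcE (hb : 4 < b) (hx : 0 ≤ x) : F (-1) b (arcE b x) = arcA b (-b) := by
  simp only [F, arcE, arcA]
  rw [abs_of_nonneg hx, abs_of_nonneg (by linarith)]
  ext <;> simp <;> ring

end Images

/-! ### The graph as a union of arcs -/

lemma segment_eq_image_Icc {f : ℝ → ℝ × ℝ} {u v m c : ℝ} (huv : u ≤ v)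
    (hf : ∀ x, f x = (x, m * x + c)) : segment ℝ (f u) (f v) = f '' Icc u v := by
  have : f = AffineMap.lineMap (0, c) (1, m + c) := by
    funext x
    rw [hf]
    ext <;> simp [AffineMap.lineMap_apply] <;> ring
  rw [← segment_eq_Icc huv, this, image_segment]

lemma graph_eq {b : ℝ} (hb : 4 < b) : Graph b =
    arcA b '' Icc (-b - 2) (b - 2) ∪ arcB b '' Icc (-b - 2) b ∪ arcC b '' Icc 0 (b + 2) ∪
      arcD b '' Icc (b - 2) (b + 4) ∪ arcE b '' Icc 0 b := by
  rw [Graph, ← segment_eq_image_Icc (m := 1) (c := b + 1) (by linarith)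
      (fun x => by simp [arcA]; ring),
    ← segment_eq_image_Icc (m := 0) (c := -1) (by linarith) (fun x => by simp [arcB]),
    ← segment_eq_image_Icc (m := -1) (c := b - 1) (by linarith) (fun x => by simp [arcC]; ring),
    ← segment_eq_image_Icc (m := 0) (c := 2 * b - 1) (by linarith) (fun x => by simp [arcD]),
    ← segment_eq_image_Icc (m := 1) (c := b - 1) (by linarith) (fun x => by simp [arcE]; ring)]
  congr 1
  congr 1
  congr 1
  congr 1
  all_goals congr 1 <;> simp [arcA, arcC, arcE] <;> ring

lemma isCompact_graph {b : ℝ} (hb : 4 < b) : IsCompact (Graph b) := by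
  rw [graph_eq hb]
  exact ((((isCompact_Icc.image (continuous_arcA b)).union
    (isCompact_Icc.image (continuous_arcB b))).union
    (isCompact_Icc.image (continuous_arcC b))).union
    (isCompact_Icc.image (continuous_arcD b))).union
    (isCompact_Icc.image (continuous_arcE b))

lemma image_graph {b : ℝ} (hb : 4 < b) : F (-1) b '' Graph b = Graph b := by
  apply Subset.antisymm
  · rintro _ ⟨z, hz, rfl⟩
    rw [graph_eq hb] at hz ⊢
    rcases hz with (((hz | hz) | hz) | hz) | hz
    · obtain ⟨x, hx, rfl⟩ := hz
      rcases le_total 0 x with h0 | h0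
      · rw [F_arcA_of_nonneg hb h0]
        exact Or.inl <| Or.inl <| Or.inl <| Or.inl ⟨_, ⟨by linarith, by linarith⟩, rfl⟩
      rcases le_total x (-b - 1) with h1 | h1
      · rw [F_arcA_of_le hb h1]
        exact Or.inl <| Or.inl <| Or.inr ⟨_, ⟨by linarith, by linarith [hx.1]⟩, rfl⟩
      · rw [F_arcA_of_mem h1 h0]
        exact Or.inl <| Or.inl <| Or.inl <| Or.inr ⟨_, ⟨by linarith, by linarith⟩, rfl⟩
    · obtain ⟨x, hx, rfl⟩ := hz
      rcases le_total 0 x with h0 | h0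
      · rw [F_arcB_of_nonneg h0]
        exact Or.inr ⟨_, ⟨h0, hx.2⟩, rfl⟩
      · rw [F_arcB_of_nonpos h0]
        exact Or.inl <| Or.inl <| Or.inr ⟨_, ⟨by linarith, by linarith [hx.1]⟩, rfl⟩
    · obtain ⟨x, hx, rfl⟩ := hz
      rcases le_total x (b - 1) with h0 | h0
      · rw [F_arcC_of_le hx.1 h0]
        exact Or.inl <| Or.inl <| Or.inl <| Or.inl ⟨_, ⟨by linarith [hx.1], by linarith⟩, rfl⟩
      · rw [F_arcC_of_ge hb h0]
        exact Or.inl <| Or.inr ⟨_, ⟨by linarith, by linarith [hx.2]⟩, rfl⟩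
    · obtain ⟨x, hx, rfl⟩ := hz
      rw [F_arcD hb (by linarith [hx.1])]
      exact Or.inl <| Or.inl <| Or.inl <| Or.inl
        ⟨_, ⟨by linarith [hx.1], by linarith [hx.2]⟩, rfl⟩
    · obtain ⟨x, hx, rfl⟩ := hz
      rw [F_arcE hb hx.1]
      exact Or.inl <| Or.inl <| Or.inl <| Or.inl ⟨_, ⟨by linarith, by linarith⟩, rfl⟩
  · intro z hz
    rw [graph_eq hb] at hz
    rw [graph_eq hb]
    rcases hz with (((hz | hz) | hz) | hz) | hz
    · obtain ⟨x, hx, rfl⟩ := hz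
      rcases le_total (-b) x with h0 | h0
      · refine ⟨arcC b ((x + b) / 2), Or.inl <| Or.inl <| Or.inr
          ⟨_, ⟨by linarith, by linarith [hx.2]⟩, rfl⟩, ?_⟩
        rw [F_arcC_of_le (by linarith) (by linarith [hx.2])]
        congr 1; ring
      · refine ⟨arcD b (x + 2 * b), Or.inl <| Or.inr
          ⟨_, ⟨by linarith [hx.1], by linarith⟩, rfl⟩, ?_⟩
        rw [F_arcD hb (by linarith [hx.1])]
        congr 1; ring
    · obtain ⟨x, hx, rfl⟩ := hz
      refine ⟨arcA b (-(x + b + 2) / 2), Or.inl <| Or.inl <| Or.inl <| Or.inl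
        ⟨_, ⟨by linarith [hx.2], by linarith [hx.1]⟩, rfl⟩, ?_⟩
      rw [F_arcA_of_mem (by linarith [hx.2]) (by linarith [hx.1])]
      congr 1; ring
    · obtain ⟨x, hx, rfl⟩ := hz
      refine ⟨arcB b (-x), Or.inl <| Or.inl <| Or.inl <| Or.inr
        ⟨_, ⟨by linarith [hx.2], by linarith [hx.1]⟩, rfl⟩, ?_⟩
      rw [F_arcB_of_nonpos (by linarith [hx.1]), neg_neg]
    · obtain ⟨x, hx, rfl⟩ := hz
      refine ⟨arcC b ((x + b) / 2), Or.inl <| Or.inl <| Or.inr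
        ⟨_, ⟨by linarith [hx.1], by linarith [hx.2]⟩, rfl⟩, ?_⟩
      rw [F_arcC_of_ge hb (by linarith [hx.1])]
      congr 1; ring
    · obtain ⟨x, hx, rfl⟩ := hz
      refine ⟨arcB b x, Or.inl <| Or.inl <| Or.inl <| Or.inr
        ⟨_, ⟨by linarith [hx.1], hx.2⟩, rfl⟩, ?_⟩
      rw [F_arcB_of_nonneg hx.1]

set_option linter.unusedSectionVars false

/-! ### Splitting numbers of arcs of the graph -/

/-- The splitting number of an arc under `F (-1) b`, as a real number. -/
noncomputable def num (b ε : ℝ) (γ : ℝ → ℝ × ℝ) (u v : ℝ) (n : ℕ) : ℝ :=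
  splitNum (F (-1) b) ε γ u v n

/-- `M` cuts `[-20, 20]` into pieces of length at most `ε`. -/
def IsMesh (ε : ℝ) (M : Finset ℝ) : Prop :=
  ∀ s t, -20 ≤ s → s ≤ t → t ≤ 20 → (∀ p ∈ M, ¬(s < p ∧ p < t)) → t - s ≤ ε

/-- The fixed point of the third iterate on the arc `A`. -/
noncomputable def fixedPt (b : ℝ) : ℝ := -(b + 4) / 3

/-- The splitting number of the arc `A` over the return interval `[fixedPt b, 4 - b]`. -/
noncomputable def numJ (b ε : ℝ) (n : ℕ) : ℝ := num b ε (arcA b) (fixedPt b) (4 - b) n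

section Num

variable {b ε : ℝ} {γ γ' : ℝ → ℝ × ℝ} {u v u' v' : ℝ} {n : ℕ} {M : Finset ℝ}

lemma num_zero : num b ε γ u v 0 = 0 := by simp [num, splitNum_zero]

lemma num_self (hε : 0 < ε) : num b ε γ u u n = 0 := by simp [num, splitNum_self hε.le]

lemma num_le_add (hε : 0 < ε) (hγ : Continuous γ) (w : ℝ) :
    num b ε γ u v n ≤ num b ε γ u w n + num b ε γ w v n + 1 := by
  unfold num
  exact_mod_cast splitNum_le_add (continuous_F _ _) hγ hε w

/-- For 4 < b < 8 the first coordinates on the graph lie between -10 and 12, so one mesh of [-20,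
20] serves all arcs. The value 20 also appears later as a crude right end point. -/
lemma num_le_of_affine (hε : 0 < ε) (hM : IsMesh ε M) (hγ : ∀ s t, dist (γ s) (γ t) ≤ |s - t|)
    (hγ' : Continuous γ') (hu : -20 ≤ u) (hv : v ≤ 20) (a c : ℝ)
    (hTγ : ∀ x, u ≤ x → x ≤ v → F (-1) b (γ x) = γ' (a * x + c))
    (hmap : ∀ x, u ≤ x → x ≤ v → u' ≤ a * x + c ∧ a * x + c ≤ v') :
    num b ε γ u v n ≤ num b ε γ' u' v' (n - 1) + M.card := by
  unfold num
  exact_mod_cast splitNum_le_of_affine (continuous_F _ _) hγ' hε hγ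
    (fun s t hs hst ht => hM s t (hu.trans hs) hst (ht.trans hv)) hTγ hmap

variable (hb : 4 < b) (hb8 : b < 8) (hε : 0 < ε) (hM : IsMesh ε M)

include hb hb8 hε hM

lemma num_arcE_le (hu : 0 ≤ u) (hv : v ≤ b) : num b ε (arcE b) u v n ≤ M.card := by
  have h := num_le_of_affine (n := n) (u' := -b) (v' := -b) hε hM (dist_arcE b) (continuous_arcA b)
    (by linarith) (by linarith) 0 (-b)
    (fun x h1 _ => (F_arcE hb (hu.trans h1)).trans (by rw [zero_mul, zero_add]))
    (fun x _ _ => by simp)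
  rwa [num_self hε, zero_add] at h

lemma num_arcA_flat_right (hu : 0 ≤ u) (hv : v ≤ 20) : num b ε (arcA b) u v n ≤ M.card := by
  have h := num_le_of_affine (n := n) (u' := -b - 2) (v' := -b - 2) hε hM (dist_arcA b)
    (continuous_arcA b) (by linarith) hv 0 (-b - 2)
    (fun x h1 _ => (F_arcA_of_nonneg hb (hu.trans h1)).trans (by rw [zero_mul, zero_add]))
    (fun x _ _ => by simp)
  rwa [num_self hε, zero_add] at h

lemma num_arcD_le (hu : b - 2 ≤ u) (hv : v ≤ b + 4) (hu' : u' ≤ u - 2 * b)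
    (hv' : v - 2 * b ≤ v') :
    num b ε (arcD b) u v n ≤ num b ε (arcA b) u' v' (n - 1) + M.card :=
  num_le_of_affine hε hM (dist_arcD b) (continuous_arcA b) (by linarith) (by linarith) 1 (-2 * b)
    (fun x h1 _ => (F_arcD hb (by linarith)).trans (by congr 1; ring))
    (fun x _ _ => ⟨by linarith, by linarith⟩)

lemma num_arcC_le_arcA (hu : 0 ≤ u) (hv : v ≤ b - 1) (hu' : u' ≤ 2 * u - b)
    (hv' : 2 * v - b ≤ v') :
    num b ε (arcC b) u v n ≤ num b ε (arcA b) u' v' (n - 1) + M.card :=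
  num_le_of_affine hε hM (dist_arcC b) (continuous_arcA b) (by linarith) (by linarith) 2 (-b)
    (fun x h1 h2 => (F_arcC_of_le (hu.trans h1) (h2.trans hv)).trans (by congr 1))
    (fun x _ _ => ⟨by linarith, by linarith⟩)

lemma num_arcC_le_arcD (hu : b - 1 ≤ u) (hv : v ≤ b + 2) (hu' : u' ≤ 2 * u - b)
    (hv' : 2 * v - b ≤ v') :
    num b ε (arcC b) u v n ≤ num b ε (arcD b) u' v' (n - 1) + M.card :=
  num_le_of_affine hε hM (dist_arcC b) (continuous_arcD b) (by linarith) (by linarith) 2 (-b)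
    (fun x h1 h2 => (F_arcC_of_ge hb (hu.trans h1)).trans (by congr 1))
    (fun x _ _ => ⟨by linarith, by linarith⟩)

lemma num_arcB_le_arcC (hu : -b - 2 ≤ u) (hv : v ≤ 0) (hu' : u' ≤ -v) (hv' : -u ≤ v') :
    num b ε (arcB b) u v n ≤ num b ε (arcC b) u' v' (n - 1) + M.card :=
  num_le_of_affine hε hM (dist_arcB b) (continuous_arcC b) (by linarith) (by linarith) (-1) 0
    (fun x h1 h2 => (F_arcB_of_nonpos (h2.trans hv)).trans (by congr 1; ring))
    (fun x _ _ => ⟨by linarith, by linarith⟩)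

lemma num_arcB_le_arcE (hu : 0 ≤ u) (hv : v ≤ b) (hu' : u' ≤ u) (hv' : v ≤ v') :
    num b ε (arcB b) u v n ≤ num b ε (arcE b) u' v' (n - 1) + M.card :=
  num_le_of_affine hε hM (dist_arcB b) (continuous_arcE b) (by linarith) (by linarith) 1 0
    (fun x h1 h2 => (F_arcB_of_nonneg (hu.trans h1)).trans (by congr 1; ring))
    (fun x _ _ => ⟨by linarith, by linarith⟩)

lemma num_arcA_le_arcB (hu : -b - 1 ≤ u) (hv : v ≤ 0) (hu' : u' ≤ -2 * v - b - 2)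
    (hv' : -2 * u - b - 2 ≤ v') :
    num b ε (arcA b) u v n ≤ num b ε (arcB b) u' v' (n - 1) + M.card :=
  num_le_of_affine hε hM (dist_arcA b) (continuous_arcB b) (by linarith) (by linarith) (-2) (-b - 2)
    (fun x h1 h2 => (F_arcA_of_mem (hu.trans h1) (h2.trans hv)).trans (by congr 1; ring))
    (fun x _ _ => ⟨by linarith, by linarith⟩)

lemma num_arcA_le_arcC (hu : -b - 2 ≤ u) (hv : v ≤ -b - 1) (hu' : u' ≤ -2 * v - b - 2)
    (hv' : -2 * u - b - 2 ≤ v') :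
    num b ε (arcA b) u v n ≤ num b ε (arcC b) u' v' (n - 1) + M.card :=
  num_le_of_affine hε hM (dist_arcA b) (continuous_arcC b) (by linarith) (by linarith) (-2) (-b - 2)
    (fun x h1 h2 => (F_arcA_of_le hb (h2.trans hv)).trans (by congr 1; ring))
    (fun x _ _ => ⟨by linarith, by linarith⟩)

/-! ### Returns to the arc `A` -/

/-- Itinerary A, B, C, A with slopes -2, -1, 2: one turn around the repelling cycle of f. -/
lemma num_arcA_expand (hu : -(b + 2) / 2 ≤ u) (hv : v ≤ -3 / 2) (hu' : u' ≤ 4 * u + b + 4)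
    (hv' : 4 * v + b + 4 ≤ v') :
    num b ε (arcA b) u v n ≤ num b ε (arcA b) u' v' (n - 3) + 3 * M.card := by
  have h1 := num_arcA_le_arcB (n := n) hb hb8 hε hM (u := u) (v := v)
    (by linarith) (by linarith) le_rfl le_rfl
  have h2 := num_arcB_le_arcC (n := n - 1) hb hb8 hε hM (u := -2 * v - b - 2)
    (v := -2 * u - b - 2) (by linarith) (by linarith) le_rfl le_rfl
  have h3 := num_arcC_le_arcA (n := n - 1 - 1) hb hb8 hε hM (u := -(-2 * u - b - 2))
    (v := -(-2 * v - b - 2)) (u' := u') (v' := v') (by linarith) (by linarith) (by linarith)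
    (by linarith)
  rw [show n - 1 - 1 - 1 = n - 3 by omega] at h3
  linarith

/-- Itinerary A, B, C, D, A. To the right of -3/2 the orbit passes b - 1 on C, where the second
coordinate becomes negative, and is deflected to the arc D. -/
lemma num_arcA_fold (hu : -3 / 2 ≤ u) (hv : v ≤ 0) (hu' : u' ≤ 4 * u - b + 4)
    (hv' : 4 * v - b + 4 ≤ v') :
    num b ε (arcA b) u v n ≤ num b ε (arcA b) u' v' (n - 4) + 4 * M.card := by
  have h1 := num_arcA_le_arcB (n := n) hb hb8 hε hM (u := u) (v := v)
    (by linarith) (by linarith) le_rfl le_rfl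
  have h2 := num_arcB_le_arcC (n := n - 1) hb hb8 hε hM (u := -2 * v - b - 2)
    (v := -2 * u - b - 2) (by linarith) (by linarith) le_rfl le_rfl
  have h3 := num_arcC_le_arcD (n := n - 1 - 1) hb hb8 hε hM (u := -(-2 * u - b - 2))
    (v := -(-2 * v - b - 2)) (by linarith) (by linarith) le_rfl le_rfl
  have h4 := num_arcD_le (n := n - 1 - 1 - 1) hb hb8 hε hM
    (u := 2 * -(-2 * u - b - 2) - b) (v := 2 * -(-2 * v - b - 2) - b) (u' := u') (v' := v')
    (by linarith) (by linarith) (by linarith) (by linarith)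
  rw [show n - 1 - 1 - 1 - 1 = n - 4 by omega] at h4
  linarith

/-- Itinerary A, C, D, A. This end of A lies below the horizontal axis, so B is skipped; its factor
-1 is missing and the orientation is reversed. -/
lemma num_arcA_reverse (hu : -b - 2 ≤ u) (hv : v ≤ -b - 1) (hu' : u' ≤ -4 * v - 5 * b - 4)
    (hv' : -4 * u - 5 * b - 4 ≤ v') :
    num b ε (arcA b) u v n ≤ num b ε (arcA b) u' v' (n - 3) + 3 * M.card := by
  have h1 := num_arcA_le_arcC (n := n) hb hb8 hε hM (u := u) (v := v) hu hv le_rfl le_rfl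
  have h3 := num_arcC_le_arcD (n := n - 1) hb hb8 hε hM (u := -2 * v - b - 2)
    (v := -2 * u - b - 2) (by linarith) (by linarith) le_rfl le_rfl
  have h4 := num_arcD_le (n := n - 1 - 1) hb hb8 hε hM
    (u := 2 * (-2 * v - b - 2) - b) (v := 2 * (-2 * u - b - 2) - b) (u' := u') (v' := v')
    (by linarith) (by linarith) (by linarith) (by linarith)
  rw [show n - 1 - 1 - 1 = n - 3 by omega] at h4
  linarith

/-- Itinerary A, B, E, and then a single point, because F collapses E. -/
lemma num_arcA_flat_left (hu : -b - 1 ≤ u) (hv : v ≤ -(b + 2) / 2) :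
    num b ε (arcA b) u v n ≤ 3 * M.card := by
  have h1 := num_arcA_le_arcB (n := n) hb hb8 hε hM (u := u) (v := v) hu (by linarith) le_rfl le_rfl
  have h2 := num_arcB_le_arcE (n := n - 1) hb hb8 hε hM (u := -2 * v - b - 2)
    (v := -2 * u - b - 2) (by linarith) (by linarith) le_rfl le_rfl
  have h3 := num_arcE_le (n := n - 1 - 1) hb hb8 hε hM (u := -2 * v - b - 2)
    (v := -2 * u - b - 2) (by linarith) (by linarith)
  linarith

/-- A turn requires w ≤ (2b-1)/6, that is, a point at most -3/2. The last turn may leave this range,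
hence the factor 4 in the bound. -/
lemma num_arcA_expand_iterate (k : ℕ) : ∀ {u v : ℝ} {n : ℕ}, 0 ≤ u → 0 ≤ v →
    4 ^ k * v ≤ 4 * ((2 * b - 1) / 6) →
    num b ε (arcA b) (fixedPt b + u) (fixedPt b + v) n ≤
      num b ε (arcA b) (fixedPt b + 4 ^ k * u) (fixedPt b + 4 ^ k * v) (n - 3 * k) +
        3 * k * M.card := by
  induction k with
  | zero => intro u v n _ _ _; simp
  | succ k ih =>
    intro u v n hu hv hk
    have h4 : (1 : ℝ) ≤ 4 ^ k := one_le_pow₀ (by norm_num)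
    have hk' : 4 ^ k * (4 * v) ≤ 4 * ((2 * b - 1) / 6) := by rw [pow_succ] at hk; linarith
    have hv' : v ≤ (2 * b - 1) / 6 := by nlinarith
    have h1 := num_arcA_expand (n := n) hb hb8 hε hM (u := fixedPt b + u) (v := fixedPt b + v)
      (u' := fixedPt b + 4 * u) (v' := fixedPt b + 4 * v) (by unfold fixedPt; linarith)
      (by unfold fixedPt; linarith) (by unfold fixedPt; linarith) (by unfold fixedPt; linarith)
    have h2 := ih (u := 4 * u) (v := 4 * v) (n := n - 3) (by linarith) (by linarith) hk'
    rw [show n - 3 - 3 * k = n - 3 * (k + 1) by omega, ← mul_assoc, ← mul_assoc, ← pow_succ] at h2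
    push_cast
    linarith

end Num

/-- The sequence `a` is bounded above by a multiple of `x ^ n`. -/
def Grows (x : ℝ) (a : ℕ → ℝ) : Prop := ∃ C, 0 ≤ C ∧ ∀ n, a n ≤ C * x ^ n

section Grows

variable {x : ℝ} {a a' : ℕ → ℝ}

lemma Grows.add (h : Grows x a) (h' : Grows x a') : Grows x fun n => a n + a' n := by
  obtain ⟨C, hC, h⟩ := h
  obtain ⟨C', hC', h'⟩ := h'
  exact ⟨C + C', by linarith, fun n => by linarith [h n, h' n]⟩

lemma Grows.mono (h : Grows x a) (h' : ∀ n, a' n ≤ a n) : Grows x a' := by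
  obtain ⟨C, hC, h⟩ := h
  exact ⟨C, hC, fun n => (h' n).trans (h n)⟩

lemma Grows.const (hx : 1 < x) (c : ℝ) : Grows x fun _ => c :=
  ⟨|c|, abs_nonneg c, fun _ => (le_abs_self c).trans
    (le_mul_of_one_le_right (abs_nonneg c) (one_le_pow₀ hx.le))⟩

lemma Grows.delay (hx : 1 < x) (h : Grows x a) (k : ℕ) : Grows x fun n => a (n - k) := by
  obtain ⟨C, hC, h⟩ := h
  refine ⟨C, hC, fun n => (h _).trans ?_⟩
  gcongr
  · exact hx.le
  · omega

lemma Grows.of_le_sum_delay (hx : 1 < x) (ha0 : a 0 = 0) {l : List ℕ} (hl : ∀ k ∈ l, 0 < k)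
    (hs : weight l x < 1) (h' : Grows x a')
    (hrec : ∀ n, a n ≤ (l.map fun k => a (n - k)).sum + a' n) : Grows x a := by
  obtain ⟨D, hD, h'⟩ := h'
  exact exists_le_mul_pow_of_le_sum_delay (zero_lt_one.trans hx) ha0 hD l hl hs
    fun n => (hrec n).trans (by linarith [h' n])

end Grows

/-! ### The recursion for the splitting numbers of the return interval -/

section Recursion

variable {b ε x : ℝ} {u v : ℝ} {M : Finset ℝ}

variable (hb : 4 < b) (hb8 : b < 8) (hε : 0 < ε) (hM : IsMesh ε M) (hx : 1 < x)

include hb hb8 hε hM hx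

/-- Points left of f drift away from it into the stretch that collapses. Each turn costs a constant
number of cuts, so the growth is below every exponential rate. -/
lemma grows_left : Grows x (num b ε (arcA b) (-b - 1) (fixedPt b)) := by
  have hL : Grows x (num b ε (arcA b) (-(b + 2) / 2) (fixedPt b)) := by
    refine Grows.of_le_sum_delay hx num_zero (l := [3]) (by simp) ?_
      (Grows.const hx (6 * M.card + 1)) fun n => ?_
    · simpa using inv_lt_one_of_one_lt₀ (one_lt_pow₀ hx (by norm_num : (3 : ℕ) ≠ 0))
    · have h1 := num_arcA_expand (n := n) hb hb8 hε hM (u := -(b + 2) / 2) (v := fixedPt b)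
        (u' := -b) (v' := fixedPt b) le_rfl (by unfold fixedPt; linarith) (by linarith)
        (by unfold fixedPt; linarith)
      have h2 := num_le_add (b := b) (u := -b) (v := fixedPt b) (n := n - 3) hε (continuous_arcA b)
        (-(b + 2) / 2)
      have h3 := num_arcA_flat_left (n := n - 3) hb hb8 hε hM (u := -b) (v := -(b + 2) / 2)
        (by linarith) le_rfl
      simp only [List.map_cons, List.map_nil, List.sum_cons, List.sum_nil]
      linarith
  refine (hL.add (Grows.const hx (3 * M.card + 1))).mono fun n => ?_
  have h2 := num_le_add (b := b) (u := -b - 1) (v := fixedPt b) (n := n) hε (continuous_arcA b)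
    (-(b + 2) / 2)
  have h3 := num_arcA_flat_left (n := n) hb hb8 hε hM (u := -b - 1) (v := -(b + 2) / 2)
    le_rfl le_rfl
  linarith

lemma num_reverse_le (hu : -b - 2 ≤ u) (hv : v ≤ -b - 1) :
    ∃ e, Grows x e ∧ ∀ n, num b ε (arcA b) u v n ≤ numJ b ε (n - 3) + e n := by
  refine ⟨_, ((grows_left hb hb8 hε hM hx).delay hx 3).add (Grows.const hx (3 * M.card + 1)),
    fun n => ?_⟩
  have h1 := num_arcA_reverse (n := n) hb hb8 hε hM (u := u) (v := v) (u' := -b - 1) (v' := 4 - b)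
    hu hv (by linarith) (by linarith)
  have h2 := num_le_add (b := b) (u := -b - 1) (v := 4 - b) (n := n - 3) hε (continuous_arcA b)
    (fixedPt b)
  unfold numJ
  linarith

/-- The fold sends f + b/2 to f. Below that point the image can return to J only through the
reversing end of A, after three more steps. -/
lemma num_fold_low_le (hu : -3 / 2 ≤ u) (hv : v ≤ fixedPt b + b / 2) :
    ∃ e, Grows x e ∧ ∀ n, num b ε (arcA b) u v n ≤ numJ b ε (n - 7) + e n := by
  obtain ⟨e, he, h⟩ := num_reverse_le hb hb8 hε hM hx (u := -b - 2) (v := -b - 1) le_rfl le_rfl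
  refine ⟨_, (he.delay hx 4).add <| ((grows_left hb hb8 hε hM hx).delay hx 4).add
    (Grows.const hx (4 * M.card + 1)), fun n => ?_⟩
  have h1 := num_arcA_fold (n := n) hb hb8 hε hM (u := u) (v := v) (u' := -b - 2) (v' := fixedPt b)
    hu (by unfold fixedPt at hv; linarith) (by linarith) (by unfold fixedPt at hv ⊢; linarith)
  have h2 := num_le_add (b := b) (u := -b - 2) (v := fixedPt b) (n := n - 4) hε (continuous_arcA b)
    (-b - 1)
  have h3 := h (n - 4)
  rw [show n - 4 - 3 = n - 7 by omega] at h3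
  linarith

lemma num_fold_high_le (hu : fixedPt b + b / 2 ≤ u) (hv : v ≤ 0) :
    ∃ e, Grows x e ∧ ∀ n, num b ε (arcA b) u v n ≤ numJ b ε (n - 4) + e n :=
  ⟨_, Grows.const hx (4 * M.card), fun n => num_arcA_fold hb hb8 hε hM
    (by unfold fixedPt at hu; linarith) hv (by unfold fixedPt at hu ⊢; linarith) (by linarith)⟩

lemma num_fold_le (hu : -3 / 2 ≤ u) (hv : v ≤ 0) :
    ∃ e, Grows x e ∧ ∀ n, num b ε (arcA b) u v n ≤ numJ b ε (n - 4) + numJ b ε (n - 7) + e n := by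
  obtain ⟨e, he, h⟩ := num_fold_low_le hb hb8 hε hM hx (u := u) (v := fixedPt b + b / 2) hu le_rfl
  obtain ⟨e', he', h'⟩ := num_fold_high_le hb hb8 hε hM hx (u := fixedPt b + b / 2) (v := v)
    le_rfl hv
  refine ⟨_, (he.add he').add (Grows.const hx 1), fun n => ?_⟩
  have h2 := num_le_add (b := b) (u := u) (v := v) (n := n) hε (continuous_arcA b)
    (fixedPt b + b / 2)
  linarith [h n, h' n]

/-- The offset (7b+4)/24 is the one that fold and reversal together send to f. Between the two
windows the orbit comes back left of f and contributes nothing exponential. -/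
lemma grows_fold_mid (hu : fixedPt b + (7 * b + 4) / 24 ≤ u) (hv : v ≤ fixedPt b + b / 2) :
    Grows x (num b ε (arcA b) u v) := by
  have hL := grows_left hb hb8 hε hM hx
  refine ((hL.delay hx 4).add <| (hL.delay hx 7).add (Grows.const hx (7 * M.card + 1))).mono
    fun n => ?_
  have h1 := num_arcA_fold (n := n) hb hb8 hε hM (u := u) (v := v)
    (u' := -(fixedPt b + 5 * b + 4) / 4) (v' := fixedPt b)
    (by unfold fixedPt at hu; linarith) (by unfold fixedPt at hv; linarith)
    (by unfold fixedPt at hu ⊢; linarith) (by unfold fixedPt at hv ⊢; linarith)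
  have h2 := num_le_add (b := b) (u := -(fixedPt b + 5 * b + 4) / 4) (v := fixedPt b) (n := n - 4)
    hε (continuous_arcA b) (-b - 1)
  have h3 := num_arcA_reverse (n := n - 4) hb hb8 hε hM (u := -(fixedPt b + 5 * b + 4) / 4)
    (v := -b - 1) (u' := -b - 1) (v' := fixedPt b) (by unfold fixedPt; linarith) le_rfl
    (by linarith) (by linarith)
  rw [show n - 4 - 3 = n - 7 by omega] at h3
  linarith

variable {Q : ℝ}

/-- The whole domain still lies left of the folding zone, so both windows are met one turn later:
the times 4 and 7 become 7 and 10. -/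
lemma num_domain_le_of_le (hQ0 : (b + 4) / 3 ≤ 4 * Q) (hQ : Q ≤ (2 * b - 1) / 6) :
    ∃ e, Grows x e ∧ ∀ n, num b ε (arcA b) (fixedPt b + Q / 4) (fixedPt b + Q) n ≤
      numJ b ε (n - 7) + numJ b ε (n - 10) + e n := by
  obtain ⟨e, he, h⟩ := num_fold_le hb hb8 hε hM hx (u := -3 / 2) (v := 0) le_rfl le_rfl
  refine ⟨_, (he.delay hx 3).add (Grows.const hx (8 * M.card + 2)), fun n => ?_⟩
  have h1 := num_arcA_expand (n := n) hb hb8 hε hM (u := fixedPt b + Q / 4) (v := fixedPt b + Q)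
    (u' := fixedPt b + Q) (v' := 20) (by unfold fixedPt; linarith) (by unfold fixedPt; linarith)
    (by unfold fixedPt; linarith) (by unfold fixedPt; linarith)
  have h2 := num_le_add (b := b) (u := fixedPt b + Q) (v := 20) (n := n - 3)
    hε (continuous_arcA b) (-3 / 2)
  have h3 := num_le_add (b := b) (u := -3 / 2) (v := 20) (n := n - 3)
    hε (continuous_arcA b) 0
  have h4 := num_arcA_flat_right (n := n - 3) hb hb8 hε hM (u := 0) (v := 20) le_rfl le_rfl
  -- Since 4Q ≥ (b+4)/3, a second turn carries this part past 0, where F is constant.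
  have h5 := num_arcA_expand (n := n - 3) hb hb8 hε hM (u := fixedPt b + Q) (v := -3 / 2)
    (u' := 0) (v' := 20) (by unfold fixedPt; linarith) le_rfl
    (by unfold fixedPt; linarith) (by linarith)
  have h6 := num_arcA_flat_right (n := n - 3 - 3) hb hb8 hε hM (u := 0) (v := 20) le_rfl le_rfl
  have h7 := h (n - 3)
  rw [show n - 3 - 4 = n - 7 by omega, show n - 3 - 7 = n - 10 by omega] at h7
  linarith

/-- The point f + Q cuts the folding zone: what lies left of it is met at once, what lies right of
it after one more turn. -/
lemma num_domain_le_split (hQ0 : 0 ≤ Q) :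
    ∀ n, num b ε (arcA b) (fixedPt b + Q / 4) (fixedPt b + Q) n ≤
      num b ε (arcA b) (-3 / 2) (fixedPt b + Q) n +
        num b ε (arcA b) (fixedPt b + Q) 0 (n - 3) + (4 * M.card + 2) := by
  intro n
  have h2 := num_le_add (b := b) (u := fixedPt b + Q / 4) (v := fixedPt b + Q) (n := n)
    hε (continuous_arcA b) (-3 / 2)
  have h1 := num_arcA_expand (n := n) hb hb8 hε hM (u := fixedPt b + Q / 4) (v := -3 / 2)
    (u' := fixedPt b + Q) (v' := 20) (by unfold fixedPt; linarith) (by linarith)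
    (by unfold fixedPt; linarith) (by linarith)
  have h3 := num_le_add (b := b) (u := fixedPt b + Q) (v := 20) (n := n - 3)
    hε (continuous_arcA b) 0
  have h4 := num_arcA_flat_right (n := n - 3) hb hb8 hε hM (u := 0) (v := 20) le_rfl le_rfl
  linarith

lemma num_domain_le_of_low (hQ0 : (2 * b - 1) / 6 ≤ Q) (hQ : Q ≤ b / 2) :
    ∃ e, Grows x e ∧ ∀ n, num b ε (arcA b) (fixedPt b + Q / 4) (fixedPt b + Q) n ≤
      numJ b ε (n - 7) + numJ b ε (n - 7) + numJ b ε (n - 10) + e n := by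
  obtain ⟨e, he, h⟩ := num_fold_low_le hb hb8 hε hM hx (u := -3 / 2) (v := fixedPt b + Q)
    le_rfl (by linarith)
  obtain ⟨e', he', h'⟩ := num_fold_le hb hb8 hε hM hx (u := fixedPt b + Q) (v := 0)
    (by unfold fixedPt; linarith) le_rfl
  refine ⟨_, (he.add (he'.delay hx 3)).add (Grows.const hx (4 * M.card + 2)), fun n => ?_⟩
  have h1 := num_domain_le_split hb hb8 hε hM hx (Q := Q) (by linarith) n
  have h2 := h' (n - 3)
  rw [show n - 3 - 4 = n - 7 by omega, show n - 3 - 7 = n - 10 by omega] at h2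
  linarith [h n]

lemma num_domain_le_of_mid (hQ0 : (7 * b + 4) / 24 ≤ Q) (hQ : Q ≤ b / 2) :
    ∃ e, Grows x e ∧ ∀ n, num b ε (arcA b) (fixedPt b + Q / 4) (fixedPt b + Q) n ≤
      numJ b ε (n - 7) + numJ b ε (n - 7) + e n := by
  obtain ⟨e, he, h⟩ := num_fold_low_le hb hb8 hε hM hx (u := -3 / 2) (v := fixedPt b + Q)
    le_rfl (by linarith)
  obtain ⟨e', he', h'⟩ := num_fold_high_le hb hb8 hε hM hx (u := fixedPt b + b / 2) (v := 0)
    le_rfl le_rfl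
  have hmid := grows_fold_mid hb hb8 hε hM hx (u := fixedPt b + Q) (v := fixedPt b + b / 2)
    (by linarith) le_rfl
  refine ⟨_, ((he.add (he'.delay hx 3)).add (hmid.delay hx 3)).add
    (Grows.const hx (4 * M.card + 3)), fun n => ?_⟩
  have h1 := num_domain_le_split hb hb8 hε hM hx (Q := Q) (by linarith) n
  have h3 := num_le_add (b := b) (u := fixedPt b + Q) (v := 0) (n := n - 3)
    hε (continuous_arcA b) (fixedPt b + b / 2)
  have h2 := h' (n - 3)
  rw [show n - 3 - 4 = n - 7 by omega] at h2
  linarith [h n]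

lemma num_domain_le_of_high (hQ0 : b / 2 ≤ Q) (hQ : Q ≤ (b + 4) / 3) :
    ∃ e, Grows x e ∧ ∀ n, num b ε (arcA b) (fixedPt b + Q / 4) (fixedPt b + Q) n ≤
      numJ b ε (n - 4) + numJ b ε (n - 7) + numJ b ε (n - 7) + e n := by
  obtain ⟨e, he, h⟩ := num_fold_le hb hb8 hε hM hx (u := -3 / 2) (v := fixedPt b + Q)
    le_rfl (by unfold fixedPt; linarith)
  obtain ⟨e', he', h'⟩ := num_fold_high_le hb hb8 hε hM hx (u := fixedPt b + Q) (v := 0)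
    (by linarith) le_rfl
  refine ⟨_, (he.add (he'.delay hx 3)).add (Grows.const hx (4 * M.card + 2)), fun n => ?_⟩
  have h1 := num_domain_le_split hb hb8 hε hM hx (Q := Q) (by linarith) n
  have h2 := h' (n - 3)
  rw [show n - 3 - 4 = n - 7 by omega] at h2
  linarith [h n]

/-- The first return to `[fixedPt b, 4 - b]`: either by one turn around the repelling cycle, or after
the excursion of the fundamental domain, which starts with `k` turns. -/
lemma numJ_le (k : ℕ) (hk : 4 ^ k * ((16 - 2 * b) / 3) ≤ (b + 4) / 3) (n : ℕ) :
    numJ b ε n ≤ numJ b ε (n - 3) + num b ε (arcA b)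
      (fixedPt b + 4 ^ k * ((16 - 2 * b) / 3) / 4) (fixedPt b + 4 ^ k * ((16 - 2 * b) / 3))
      (n - 3 * k) + (3 * M.card + 3 * k * M.card + 1) := by
  set τ := (16 - 2 * b) / 3 with hτ
  have e1 : 4 - b = fixedPt b + τ := by rw [hτ, fixedPt]; ring
  have h1 := num_le_add (b := b) (u := fixedPt b) (v := fixedPt b + τ) (n := n)
    hε (continuous_arcA b) (fixedPt b + τ / 4)
  have h2 := num_arcA_expand (n := n) hb hb8 hε hM (u := fixedPt b) (v := fixedPt b + τ / 4)
    (u' := fixedPt b) (v' := fixedPt b + τ) (by unfold fixedPt; linarith)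
    (by unfold fixedPt; linarith) (by unfold fixedPt; linarith) (by unfold fixedPt; linarith)
  have h3 := num_arcA_expand_iterate hb hb8 hε hM k (u := τ / 4) (v := τ) (n := n)
    (by linarith) (by linarith) (by linarith)
  rw [← mul_div_assoc] at h3
  unfold numJ
  rw [e1]
  linarith

/-- All arcs of the graph have splitting numbers of the order of that of the return interval. -/
lemma grows_graph (hJ : Grows x (numJ b ε)) :
    Grows x (num b ε (arcA b) (-b - 2) (b - 2)) ∧ Grows x (num b ε (arcB b) (-b - 2) b) ∧
    Grows x (num b ε (arcC b) 0 (b + 2)) ∧ Grows x (num b ε (arcD b) (b - 2) (b + 4)) ∧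
    Grows x (num b ε (arcE b) 0 b) := by
  obtain ⟨e, he, h⟩ := num_reverse_le hb hb8 hε hM hx (u := -b - 2) (v := -b - 1) le_rfl le_rfl
  have hI1 : Grows x (num b ε (arcA b) (-b - 2) (-b - 1)) := ((hJ.delay hx 3).add he).mono h
  obtain ⟨e', he', h'⟩ := num_fold_le hb hb8 hε hM hx (u := -3 / 2) (v := 0) le_rfl le_rfl
  have hI4 : Grows x (num b ε (arcA b) (-3 / 2) 0) :=
    (((hJ.delay hx 4).add (hJ.delay hx 7)).add he').mono h'
  have hI3 : Grows x (num b ε (arcA b) (fixedPt b) (-3 / 2)) := by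
    refine Grows.of_le_sum_delay hx num_zero (l := [3]) (by simp) ?_
      ((hI4.delay hx 3).add (Grows.const hx (4 * M.card + 2))) fun n => ?_
    · simpa using inv_lt_one_of_one_lt₀ (one_lt_pow₀ hx (by norm_num : (3 : ℕ) ≠ 0))
    · have h1 := num_arcA_expand (n := n) hb hb8 hε hM (u := fixedPt b) (v := -3 / 2)
        (u' := fixedPt b) (v' := 20) (by unfold fixedPt; linarith) le_rfl
        (by unfold fixedPt; linarith) (by linarith)
      have h2 := num_le_add (b := b) (u := fixedPt b) (v := 20) (n := n - 3) hε (continuous_arcA b)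
        (-3 / 2)
      have h3 := num_le_add (b := b) (u := -3 / 2) (v := 20) (n := n - 3) hε (continuous_arcA b) 0
      have h4 := num_arcA_flat_right (n := n - 3) hb hb8 hε hM (u := 0) (v := 20) le_rfl le_rfl
      simp only [List.map_cons, List.map_nil, List.sum_cons, List.sum_nil]
      linarith
  have hA : Grows x (num b ε (arcA b) (-b - 2) (b - 2)) := by
    refine ((((hI1.add (grows_left hb hb8 hε hM hx)).add hI3).add hI4).add
      (Grows.const hx (M.card + 4))).mono fun n => ?_
    have h1 := num_le_add (b := b) (u := -b - 2) (v := b - 2) (n := n) hε (continuous_arcA b)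
      (-b - 1)
    have h2 := num_le_add (b := b) (u := -b - 1) (v := b - 2) (n := n) hε (continuous_arcA b)
      (fixedPt b)
    have h3 := num_le_add (b := b) (u := fixedPt b) (v := b - 2) (n := n) hε (continuous_arcA b)
      (-3 / 2)
    have h4 := num_le_add (b := b) (u := -3 / 2) (v := b - 2) (n := n) hε (continuous_arcA b) 0
    have h5 := num_arcA_flat_right (n := n) hb hb8 hε hM (u := 0) (v := b - 2) le_rfl
      (by linarith)
    linarith
  have hD : Grows x (num b ε (arcD b) (b - 2) (b + 4)) :=
    ((hA.delay hx 1).add (Grows.const hx M.card)).mono fun n =>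
      num_arcD_le hb hb8 hε hM le_rfl le_rfl (by linarith) (by linarith)
  have hC : Grows x (num b ε (arcC b) 0 (b + 2)) := by
    refine (((hA.delay hx 1).add (hD.delay hx 1)).add (Grows.const hx (2 * M.card + 1))).mono
      fun n => ?_
    have h1 := num_le_add (b := b) (u := 0) (v := b + 2) (n := n) hε (continuous_arcC b) (b - 1)
    have h2 := num_arcC_le_arcA (n := n) hb hb8 hε hM (u := 0) (v := b - 1) (u' := -b - 2)
      (v' := b - 2) le_rfl le_rfl (by linarith) (by linarith)
    have h3 := num_arcC_le_arcD (n := n) hb hb8 hε hM (u := b - 1) (v := b + 2) (u' := b - 2)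
      (v' := b + 4) le_rfl le_rfl (by linarith) (by linarith)
    linarith
  have hE : Grows x (num b ε (arcE b) 0 b) :=
    (Grows.const hx M.card).mono fun n => num_arcE_le hb hb8 hε hM le_rfl le_rfl
  refine ⟨hA, ((((hC.delay hx 1).add (hE.delay hx 1)).add
    (Grows.const hx (2 * M.card + 1))).mono fun n => ?_), hC, hD, hE⟩
  have h1 := num_le_add (b := b) (u := -b - 2) (v := b) (n := n) hε (continuous_arcB b) 0
  have h2 := num_arcB_le_arcC (n := n) hb hb8 hε hM (u := -b - 2) (v := 0) (u' := 0)
    (v' := b + 2) le_rfl le_rfl (by linarith) (by linarith)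
  have h3 := num_arcB_le_arcE (n := n) hb hb8 hε hM (u := 0) (v := b) le_rfl le_rfl le_rfl le_rfl
  linarith

end Recursion

/-- The entropy is at most the logarithm of the weight root of `l`, if the splitting numbers of the
return interval are dominated by the sum of their delays by the times in `l`. -/
theorem entropy_le_log {b r : ℝ} (hb : 4 < b) (hb8 : b < 8) {l : List ℕ} (hl : ∀ k ∈ l, 0 < k)
    (hne : l ≠ []) (hr : IsWeightRoot l r)
    (h : ∀ ε M x, 0 < ε → IsMesh ε M → 1 < x → ∃ e, Grows x e ∧
      ∀ n, numJ b ε n ≤ (l.map fun k => numJ b ε (n - k)).sum + e n) :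
    entropy b ≤ (Real.log r : EReal) := by
  have hr0 : 0 < r := zero_lt_one.trans hr.1
  rw [← EReal.le_of_forall_lt_iff_le]
  intro z hz
  have hz : Real.log r < z := by exact_mod_cast hz
  have hrx : r < Real.exp z := (Real.log_lt_iff_lt_exp hr0).1 hz
  have hx : 1 < Real.exp z := hr.1.trans hrx
  -- Strictly above the root the weights sum to less than one, the slack that the renewal inequality
  -- needs. The root itself is reached in the limit.
  have hw : weight l (Real.exp z) < 1 := by
    rw [← hr.2]
    exact weight_lt_weight hl hne hr0 hrx
  have key : ∀ ε : ℝ, 0 < ε →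
      Grows (Real.exp z) (num b ε (arcA b) (-b - 2) (b - 2)) ∧
      Grows (Real.exp z) (num b ε (arcB b) (-b - 2) b) ∧
      Grows (Real.exp z) (num b ε (arcC b) 0 (b + 2)) ∧
      Grows (Real.exp z) (num b ε (arcD b) (b - 2) (b + 4)) ∧
      Grows (Real.exp z) (num b ε (arcE b) 0 b) := by
    intro ε hε
    obtain ⟨M, hM⟩ := exists_finset_mesh (-20) 20 hε
    obtain ⟨e, he, hrec⟩ := h ε M _ hε hM hx
    exact grows_graph hb hb8 hε hM hx (Grows.of_le_sum_delay hx num_zero hl hw he hrec)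
  have hF := continuous_F (-1) b
  rw [entropy, graph_eq hb, coverEntropy_union, coverEntropy_union, coverEntropy_union,
    coverEntropy_union, ← Real.log_exp z]
  refine max_le (max_le (max_le (max_le ?_ ?_) ?_) ?_) ?_
  · exact coverEntropy_image_Icc_le hF (continuous_arcA b) hx.le fun ε hε =>
      (key ε hε).1.imp fun C hC => hC.2
  · exact coverEntropy_image_Icc_le hF (continuous_arcB b) hx.le fun ε hε =>
      (key ε hε).2.1.imp fun C hC => hC.2
  · exact coverEntropy_image_Icc_le hF (continuous_arcC b) hx.le fun ε hε =>
      (key ε hε).2.2.1.imp fun C hC => hC.2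
  · exact coverEntropy_image_Icc_le hF (continuous_arcD b) hx.le fun ε hε =>
      (key ε hε).2.2.2.1.imp fun C hC => hC.2
  · exact coverEntropy_image_Icc_le hF (continuous_arcE b) hx.le fun ε hε =>
      (key ε hε).2.2.2.2.imp fun C hC => hC.2

/-! ### Upper bounds according to the position of Q -/

section Cases

variable {b r : ℝ} {k : ℕ}

lemma entropy_le_of_phi (hb : 4 < b) (hb8 : b < 8)
    (hk : 4 ^ k * ((16 - 2 * b) / 3) ≤ (2 * b - 1) / 6)
    (hk' : (b + 4) / 3 ≤ 4 * (4 ^ k * ((16 - 2 * b) / 3))) (hr : IsWeightRoot (timesPhi k) r) :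
    entropy b ≤ (Real.log r : EReal) := by
  refine entropy_le_log hb hb8 (by simp [timesPhi]) (by simp [timesPhi]) hr
    fun ε M x hε hM hx => ?_
  obtain ⟨e, he, h⟩ := num_domain_le_of_le hb hb8 hε hM hx hk' hk
  refine ⟨_, (he.delay hx (3 * k)).add (Grows.const hx (3 * M.card + 3 * k * M.card + 1)),
    fun n => ?_⟩
  have h1 := numJ_le hb hb8 hε hM hx k (by linarith) n
  have h2 := h (n - 3 * k)
  rw [show n - 3 * k - 7 = n - (7 + 3 * k) by omega,
    show n - 3 * k - 10 = n - (10 + 3 * k) by omega] at h2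
  simp only [timesPhi, List.map_cons, List.map_nil, List.sum_cons, List.sum_nil]
  linarith

lemma entropy_le_of_gamma (hb : 4 < b) (hb8 : b < 8)
    (hk : (2 * b - 1) / 6 ≤ 4 ^ k * ((16 - 2 * b) / 3))
    (hk' : 4 ^ k * ((16 - 2 * b) / 3) ≤ b / 2) (hr : IsWeightRoot (timesGamma k) r) :
    entropy b ≤ (Real.log r : EReal) := by
  refine entropy_le_log hb hb8 (by simp [timesGamma]) (by simp [timesGamma]) hr
    fun ε M x hε hM hx => ?_
  obtain ⟨e, he, h⟩ := num_domain_le_of_low hb hb8 hε hM hx hk hk'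
  refine ⟨_, (he.delay hx (3 * k)).add (Grows.const hx (3 * M.card + 3 * k * M.card + 1)),
    fun n => ?_⟩
  have h1 := numJ_le hb hb8 hε hM hx k (by linarith) n
  have h2 := h (n - 3 * k)
  rw [show n - 3 * k - 7 = n - (7 + 3 * k) by omega,
    show n - 3 * k - 10 = n - (10 + 3 * k) by omega] at h2
  simp only [timesGamma, List.map_cons, List.map_nil, List.sum_cons, List.sum_nil]
  linarith

lemma entropy_le_of_delta (hb : 4 < b) (hb8 : b < 8)
    (hk : (7 * b + 4) / 24 ≤ 4 ^ k * ((16 - 2 * b) / 3))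
    (hk' : 4 ^ k * ((16 - 2 * b) / 3) ≤ b / 2) (hr : IsWeightRoot (timesDelta k) r) :
    entropy b ≤ (Real.log r : EReal) := by
  refine entropy_le_log hb hb8 (by simp [timesDelta]) (by simp [timesDelta]) hr
    fun ε M x hε hM hx => ?_
  obtain ⟨e, he, h⟩ := num_domain_le_of_mid hb hb8 hε hM hx hk hk'
  refine ⟨_, (he.delay hx (3 * k)).add (Grows.const hx (3 * M.card + 3 * k * M.card + 1)),
    fun n => ?_⟩
  have h1 := numJ_le hb hb8 hε hM hx k (by linarith) n
  have h2 := h (n - 3 * k)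
  rw [show n - 3 * k - 7 = n - (7 + 3 * k) by omega] at h2
  simp only [timesDelta, List.map_cons, List.map_nil, List.sum_cons, List.sum_nil]
  linarith

lemma entropy_le_of_beta (hb : 4 < b) (hb8 : b < 8)
    (hk : b / 2 ≤ 4 ^ k * ((16 - 2 * b) / 3))
    (hk' : 4 ^ k * ((16 - 2 * b) / 3) ≤ (b + 4) / 3) (hr : IsWeightRoot (timesBeta k) r) :
    entropy b ≤ (Real.log r : EReal) := by
  refine entropy_le_log hb hb8 (by simp [timesBeta]) (by simp [timesBeta]) hr
    fun ε M x hε hM hx => ?_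
  obtain ⟨e, he, h⟩ := num_domain_le_of_high hb hb8 hε hM hx hk hk'
  refine ⟨_, (he.delay hx (3 * k)).add (Grows.const hx (3 * M.card + 3 * k * M.card + 1)),
    fun n => ?_⟩
  have h1 := numJ_le hb hb8 hε hM hx k (by linarith) n
  have h2 := h (n - 3 * k)
  rw [show n - 3 * k - 7 = n - (7 + 3 * k) by omega,
    show n - 3 * k - 4 = n - (4 + 3 * k) by omega] at h2
  simp only [timesBeta, List.map_cons, List.map_nil, List.sum_cons, List.sum_nil]
  linarith

end Cases

/-! ### Inverse branches of the return map -/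

section Iterates

variable {b x : ℝ}

lemma iterate_arcA_expand (hx : -(b + 2) / 2 ≤ x) (hx' : x ≤ -3 / 2) (hb : 4 < b) :
    (F (-1) b)^[3] (arcA b x) = arcA b (4 * x + b + 4) := by
  simp only [Function.iterate_succ_apply, Function.iterate_zero_apply]
  rw [F_arcA_of_mem (by linarith) (by linarith), F_arcB_of_nonpos (by linarith),
    F_arcC_of_le (by linarith) (by linarith)]
  congr 1; ring

lemma iterate_arcA_fold (hx : -3 / 2 ≤ x) (hx' : x ≤ 0) (hb : 4 < b) :
    (F (-1) b)^[4] (arcA b x) = arcA b (4 * x - b + 4) := by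
  simp only [Function.iterate_succ_apply, Function.iterate_zero_apply]
  rw [F_arcA_of_mem (by linarith) (by linarith), F_arcB_of_nonpos (by linarith),
    F_arcC_of_ge hb (by linarith), F_arcD hb (by linarith)]
  congr 1; ring

lemma iterate_arcA_reverse (hx' : x ≤ -b - 1) (hb : 4 < b) :
    (F (-1) b)^[3] (arcA b x) = arcA b (-4 * x - 5 * b - 4) := by
  simp only [Function.iterate_succ_apply, Function.iterate_zero_apply]
  rw [F_arcA_of_le hb hx', F_arcC_of_ge hb (by linarith), F_arcD hb (by linarith)]
  congr 1; ring

lemma iterate_arcA_expand_pow (hb : 4 < b) (k : ℕ) : ∀ {w : ℝ}, 0 ≤ w →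
    w ≤ 4 * ((2 * b - 1) / 6) →
    (F (-1) b)^[3 * k] (arcA b (fixedPt b + w / 4 ^ k)) = arcA b (fixedPt b + w) := by
  induction k with
  | zero => intro w _ _; simp
  | succ k ih =>
    intro w hw hw'
    rw [show 3 * (k + 1) = 3 + 3 * k by ring, Function.iterate_add_apply,
      show w / 4 ^ (k + 1) = (w / 4) / 4 ^ k by rw [pow_succ]; field_simp,
      ih (by linarith) (by linarith), iterate_arcA_expand _ _ hb]
    · congr 1; unfold fixedPt; ring
    · unfold fixedPt; linarith
    · unfold fixedPt; linarith

/-- The position, relative to the fixed point, of the preimage of `x` which folds back directly. -/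
noncomputable def directOffset (b x : ℝ) : ℝ := 1 / 4 * x + ((b - 4) / 4 - fixedPt b)

/-- The position, relative to the fixed point, of the preimage of `x` which folds back with a
reversal of the orientation. -/
noncomputable def reverseOffset (b x : ℝ) : ℝ := -1 / 16 * x + (-(b + 20) / 16 - fixedPt b)

lemma directOffset_mem (hx : x ∈ Icc (fixedPt b) (4 - b)) :
    b / 2 ≤ directOffset b x ∧ directOffset b x ≤ (b + 4) / 3 := by
  obtain ⟨h1, h2⟩ := hx
  unfold directOffset fixedPt at *
  constructor <;> linarith

lemma reverseOffset_mem (hx : x ∈ Icc (fixedPt b) (4 - b)) :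
    (2 * b - 1) / 6 ≤ reverseOffset b x ∧ reverseOffset b x ≤ (7 * b + 4) / 24 := by
  obtain ⟨h1, h2⟩ := hx
  unfold reverseOffset fixedPt at *
  constructor <;> linarith

lemma iterate_direct (hb : 4 < b) (k : ℕ) (hx : x ∈ Icc (fixedPt b) (4 - b)) :
    (F (-1) b)^[4 + 3 * k] (arcA b (fixedPt b + directOffset b x / 4 ^ k)) = arcA b x := by
  obtain ⟨h1, h2⟩ := directOffset_mem hx
  rw [Function.iterate_add_apply, iterate_arcA_expand_pow hb k (by linarith) (by linarith),
    iterate_arcA_fold (by unfold fixedPt; linarith) (by unfold fixedPt; linarith) hb]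
  congr 1; unfold directOffset; ring

lemma iterate_reverse (hb : 4 < b) (k : ℕ) (hx : x ∈ Icc (fixedPt b) (4 - b)) :
    (F (-1) b)^[7 + 3 * k] (arcA b (fixedPt b + reverseOffset b x / 4 ^ k)) = arcA b x := by
  obtain ⟨h1, h2⟩ := reverseOffset_mem hx
  rw [show 7 + 3 * k = 3 + (4 + 3 * k) by ring, Function.iterate_add_apply,
    Function.iterate_add_apply _ 4, iterate_arcA_expand_pow hb k (by linarith) (by linarith),
    iterate_arcA_fold (by unfold fixedPt; linarith) (by unfold fixedPt; linarith) hb,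
    iterate_arcA_reverse _ hb]
  · congr 1; unfold reverseOffset; ring
  · unfold fixedPt; linarith

end Iterates

lemma affine_mapsTo_Ioo {u v m c : ℝ} (huv : u < v) (hm : m ≠ 0)
    (h : MapsTo (fun x => m * x + c) (Icc u v) (Icc u v)) :
    MapsTo (fun x => m * x + c) (Ioo u v) (Ioo u v) := by
  intro x hx
  obtain ⟨hu1, hu2⟩ := h (left_mem_Icc.2 huv.le)
  obtain ⟨hv1, hv2⟩ := h (right_mem_Icc.2 huv.le)
  obtain ⟨h1, h2⟩ := hx
  simp only at hu1 hu2 hv1 hv2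
  rcases lt_or_gt_of_ne hm with h0 | h0
  · have := mul_lt_mul_of_neg_left h1 h0
    have := mul_lt_mul_of_neg_left h2 h0
    constructor <;> simp only <;> linarith
  · have := mul_lt_mul_of_pos_left h1 h0
    have := mul_lt_mul_of_pos_left h2 h0
    constructor <;> simp only <;> linarith

/-- A lower bound of the entropy by affine inverse branches of the return map to the interval
`[fixedPt b, 4 - b]`, whose images lie in its fundamental domain, in addition to the contraction to
the fixed point. -/
theorem log_le_entropy {κ : Type*} [Fintype κ] [Nonempty κ] {b r : ℝ} (hb : 4 < b) (hb8 : b < 8)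
    (n : ℕ) (a d : κ → ℝ) (ha : ∀ i, a i ≠ 0) (τ : κ → ℕ) (hτ : ∀ i, 0 < τ i)
    (hmap : ∀ i, ∀ x ∈ Icc (fixedPt b) (4 - b), 4 ^ n * ((16 - 2 * b) / 3) / 4 ≤ a i * x + d i ∧
      a i * x + d i ≤ 4 ^ n * ((16 - 2 * b) / 3))
    (hF : ∀ i, ∀ x ∈ Icc (fixedPt b) (4 - b),
      (F (-1) b)^[τ i] (arcA b (fixedPt b + (a i * x + d i) / 4 ^ n)) = arcA b x)
    (hdisj : ∀ i j, i ≠ j → ∀ x ∈ Icc (fixedPt b) (4 - b), ∀ y ∈ Icc (fixedPt b) (4 - b),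
      a i * x + d i ≠ a j * y + d j)
    (hr : 0 < r) (hsum : (r ^ 3)⁻¹ + ∑ i, (r ^ τ i)⁻¹ = 1) :
    (Real.log r : EReal) ≤ entropy b := by
  have h4 : (0 : ℝ) < 4 ^ n := by positivity
  have hlt : fixedPt b < 4 - b := by unfold fixedPt; linarith
  let m : Option κ → ℝ := fun o => o.elim (1 / 4) fun i => a i / 4 ^ n
  let c : Option κ → ℝ := fun o => o.elim (3 / 4 * fixedPt b) fun i => fixedPt b + d i / 4 ^ n
  have hsome : ∀ i x, m (some i) * x + c (some i) = fixedPt b + (a i * x + d i) / 4 ^ n := by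
    intro i x
    simp only [m, c, Option.elim]
    ring
  have hnone : ∀ x, m none * x + c none = fixedPt b + (x - fixedPt b) / 4 := by
    intro x
    simp only [m, c, Option.elim]
    ring
  have hm : ∀ o, m o ≠ 0 := by
    rintro (_ | i)
    · norm_num [m]
    · exact div_ne_zero (ha i) h4.ne'
  have hdom : ∀ i, ∀ x ∈ Icc (fixedPt b) (4 - b),
      fixedPt b + (4 - b - fixedPt b) / 4 ≤ m (some i) * x + c (some i) ∧
        m (some i) * x + c (some i) ≤ 4 - b := by
    intro i x hx
    obtain ⟨h1, h2⟩ := hmap i x hx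
    have e : 4 - b - fixedPt b = (16 - 2 * b) / 3 := by unfold fixedPt; ring
    rw [hsome, e]
    have h1' : (16 - 2 * b) / 3 / 4 ≤ (a i * x + d i) / 4 ^ n := by
      rw [le_div_iff₀ h4]; linarith
    have h2' : (a i * x + d i) / 4 ^ n ≤ (16 - 2 * b) / 3 := by
      rw [div_le_iff₀ h4]; linarith
    constructor <;> linarith
  have hIcc : ∀ o, MapsTo (fun x => m o * x + c o) (Icc (fixedPt b) (4 - b))
      (Icc (fixedPt b) (4 - b)) := by
    rintro (_ | i) x hx
    · simp only [hnone]
      constructor <;> linarith [hx.1, hx.2]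
    · obtain ⟨h1, h2⟩ := hdom i x hx
      exact ⟨by linarith, h2⟩
  have hIoo := fun o => affine_mapsTo_Ioo hlt (hm o) (hIcc o)
  let T : Option κ → ℕ := fun o => o.elim 3 τ
  have hT : ∀ o, ∀ x ∈ Icc (fixedPt b) (4 - b),
      (F (-1) b)^[T o] (arcA b (m o * x + c o)) = arcA b x := by
    rintro (_ | i) x hx
    · rw [hnone]
      have := iterate_arcA_expand_pow hb 1 (w := x - fixedPt b) (by linarith [hx.1])
        (by have := hx.2; unfold fixedPt; linarith)
      rw [pow_one] at this
      simpa [T] using this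
    · rw [hsome]
      exact hF i x hx
  let g : Option κ → ℝ × ℝ → ℝ × ℝ := fun o z => arcA b (m o * z.1 + c o)
  have hg : ∀ o, Continuous (g o) := fun o => (continuous_arcA b).comp (by fun_prop)
  -- The image of the contraction to f may share an end point with another image, so disjointness is
  -- claimed only over the open interval. A branch into the fundamental domain followed by the
  -- contraction stays away from both end points of J and serves as the map into the open interval.
  obtain ⟨i₀⟩ := ‹Nonempty κ›
  refine log_le_coverEntropy_of_branches (K := arcA b '' Icc (fixedPt b) (4 - b))
    (O := arcA b '' Ioo (fixedPt b) (4 - b)) (isCompact_Icc.image (continuous_arcA b))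
    ((nonempty_Icc.2 hlt.le).image _) ?_ (image_mono Ioo_subset_Icc_self) g T ?_ hg ?_ ?_ ?_ ?_
    (g none ∘ g (some i₀)) ((hg _).comp (hg _)) (T (some i₀) + T none) ?_ ?_ hr ?_
  · rw [graph_eq hb]
    refine fun z hz => Or.inl <| Or.inl <| Or.inl <| Or.inl ?_
    refine image_mono (Icc_subset_Icc ?_ ?_) hz
    · unfold fixedPt; linarith
    · linarith
  · rintro (_ | i)
    · exact Nat.succ_pos 2
    · exact hτ i
  · rintro o _ ⟨x, hx, rfl⟩
    exact ⟨_, hIcc o hx, rfl⟩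
  · rintro o _ ⟨x, hx, rfl⟩
    exact ⟨_, hIoo o hx, rfl⟩
  · rintro o _ ⟨x, hx, rfl⟩
    exact hT o x hx
  · rintro o o' hoo _ ⟨x, hx, rfl⟩ _ ⟨y, hy, rfl⟩ h
    have h : m o * x + c o = m o' * y + c o' := congrArg Prod.fst h
    have hx' := Ioo_subset_Icc_self hx
    have hy' := Ioo_subset_Icc_self hy
    rcases o with _ | i <;> rcases o' with _ | j
    · exact hoo rfl
    · have := (hdom j y hy').1
      rw [← h, hnone] at this
      linarith [hx.2]
    · have := (hdom i x hx').1
      rw [h, hnone] at this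
      linarith [hy.2]
    · rw [hsome, hsome, add_right_inj, div_left_inj' h4.ne'] at h
      exact hdisj i j (fun e => hoo (by rw [e])) x hx' y hy' h
  · rintro _ ⟨x, hx, rfl⟩
    refine ⟨m none * (m (some i₀) * x + c (some i₀)) + c none, ?_, rfl⟩
    obtain ⟨h1, h2⟩ := hdom i₀ x hx
    rw [hnone]
    constructor <;> linarith
  · rintro _ ⟨x, hx, rfl⟩
    rw [Function.iterate_add_apply]
    have h1 := hT none _ (hIcc (some i₀) hx)
    exact (congrArg _ h1).trans (hT (some i₀) x hx)
  · rw [Fintype.sum_option]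
    exact hsum

/-! ### Lower bounds according to the position of Q -/

section Cases

variable {b r : ℝ} {n : ℕ}

lemma log_le_entropy_of_reverse (hb : 4 < b) (hb8 : b < 8)
    (hn : (7 * b + 4) / 24 ≤ 4 ^ n * ((16 - 2 * b) / 3))
    (hn' : 4 ^ n * ((16 - 2 * b) / 3) ≤ (b + 4) / 3) (hr : IsWeightRoot (timesAlpha n) r) :
    (Real.log r : EReal) ≤ entropy b := by
  refine log_le_entropy hb hb8 n (fun _ : Unit => -1 / 16)
    (fun _ => -(b + 20) / 16 - fixedPt b) (by norm_num) (fun _ => 7 + 3 * n) (by simp) ?_ ?_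
    (fun i j hij => absurd (Subsingleton.elim i j) hij) (zero_lt_one.trans hr.1) ?_
  · intro _ x hx
    obtain ⟨h1, h2⟩ := reverseOffset_mem hx
    unfold reverseOffset at h1 h2
    constructor <;> linarith
  · intro _ x hx
    exact iterate_reverse hb n hx
  · simpa [timesAlpha] using hr.2

/-- Dividing the direct offset by 4 inserts one more turn, which raises the time from 4 + 3n to 7 +
3n. -/
lemma iterate_direct_succ (hb : 4 < b) {x : ℝ} (hx : x ∈ Icc (fixedPt b) (4 - b)) :
    (F (-1) b)^[7 + 3 * n]
      (arcA b (fixedPt b + (1 / 16 * x + ((b - 4) / 4 - fixedPt b) / 4) / 4 ^ n)) = arcA b x := by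
  rw [show 7 + 3 * n = 4 + 3 * (n + 1) by ring, ← iterate_direct hb (n + 1) hx]
  congr 3
  rw [directOffset, pow_succ]
  field_simp
  ring

lemma log_le_entropy_of_direct (hb : 4 < b) (hb8 : b < 8)
    (hn : (b + 4) / 3 ≤ 4 * (4 ^ n * ((16 - 2 * b) / 3)))
    (hn' : 4 ^ n * ((16 - 2 * b) / 3) ≤ b / 2) (hr : IsWeightRoot (timesAlpha n) r) :
    (Real.log r : EReal) ≤ entropy b := by
  refine log_le_entropy hb hb8 n (fun _ : Unit => 1 / 16)
    (fun _ => ((b - 4) / 4 - fixedPt b) / 4) (by norm_num) (fun _ => 7 + 3 * n) (by simp) ?_ ?_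
    (fun i j hij => absurd (Subsingleton.elim i j) hij) (zero_lt_one.trans hr.1) ?_
  · intro _ x hx
    obtain ⟨h1, h2⟩ := directOffset_mem hx
    unfold directOffset at h1 h2
    constructor <;> linarith
  · intro _ x hx
    exact iterate_direct_succ hb hx
  · simpa [timesAlpha] using hr.2

lemma log_le_entropy_of_delta (hb : 4 < b) (hb8 : b < 8)
    (hn : (7 * b + 4) / 24 ≤ 4 ^ n * ((16 - 2 * b) / 3))
    (hn' : 4 ^ n * ((16 - 2 * b) / 3) ≤ b / 2) (hr : IsWeightRoot (timesDelta n) r) :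
    (Real.log r : EReal) ≤ entropy b := by
  have hne : ∀ x ∈ Icc (fixedPt b) (4 - b), ∀ y ∈ Icc (fixedPt b) (4 - b),
      1 / 16 * x + ((b - 4) / 4 - fixedPt b) / 4 < -1 / 16 * y + (-(b + 20) / 16 - fixedPt b) := by
    intro x hx y hy
    obtain ⟨h1, h2⟩ := directOffset_mem hx
    obtain ⟨h3, h4⟩ := reverseOffset_mem hy
    unfold directOffset at h1 h2
    unfold reverseOffset at h3 h4
    linarith
  refine log_le_entropy hb hb8 n (fun i : Bool => cond i (1 / 16) (-1 / 16))
    (fun i => cond i (((b - 4) / 4 - fixedPt b) / 4) (-(b + 20) / 16 - fixedPt b)) ?_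
    (fun _ => 7 + 3 * n) (by simp) ?_ ?_ ?_ (zero_lt_one.trans hr.1) ?_
  · rintro (_ | _) <;> norm_num
  · rintro (_ | _) x hx
    · obtain ⟨h1, h2⟩ := reverseOffset_mem hx
      unfold reverseOffset at h1 h2
      simp only [cond_false]
      constructor <;> linarith
    · obtain ⟨h1, h2⟩ := directOffset_mem hx
      unfold directOffset at h1 h2
      simp only [cond_true]
      constructor <;> linarith
  · rintro (_ | _) x hx
    · exact iterate_reverse hb n hx
    · exact iterate_direct_succ hb hx
  · rintro (_ | _) (_ | _) hij x hx y hy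
    · exact absurd rfl hij
    · exact (hne y hy x hx).ne'
    · exact (hne x hx y hy).ne
    · exact absurd rfl hij
  · rw [Fintype.sum_bool, ← hr.2]
    simp [timesDelta]

lemma log_le_entropy_of_phi (hb : 4 < b) (hb8 : b < 8)
    (hn : (b + 4) / 3 ≤ 4 * (4 ^ n * ((16 - 2 * b) / 3)))
    (hn' : 4 ^ n * ((16 - 2 * b) / 3) ≤ (2 * b - 1) / 6) (hr : IsWeightRoot (timesPhi n) r) :
    (Real.log r : EReal) ≤ entropy b := by
  have hne : ∀ x ∈ Icc (fixedPt b) (4 - b), ∀ y ∈ Icc (fixedPt b) (4 - b),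
      -1 / 64 * y + (-(b + 20) / 16 - fixedPt b) / 4 <
        1 / 16 * x + ((b - 4) / 4 - fixedPt b) / 4 := by
    intro x hx y hy
    obtain ⟨h1, h2⟩ := directOffset_mem hx
    obtain ⟨h3, h4⟩ := reverseOffset_mem hy
    unfold directOffset at h1 h2
    unfold reverseOffset at h3 h4
    linarith
  refine log_le_entropy hb hb8 n (fun i : Bool => cond i (1 / 16) (-1 / 64))
    (fun i => cond i (((b - 4) / 4 - fixedPt b) / 4) ((-(b + 20) / 16 - fixedPt b) / 4)) ?_
    (fun i => cond i (7 + 3 * n) (10 + 3 * n)) ?_ ?_ ?_ ?_ (zero_lt_one.trans hr.1) ?_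
  · rintro (_ | _) <;> norm_num
  · rintro (_ | _) <;> simp
  · rintro (_ | _) x hx
    · obtain ⟨h1, h2⟩ := reverseOffset_mem hx
      unfold reverseOffset at h1 h2
      simp only [cond_false]
      constructor <;> linarith
    · obtain ⟨h1, h2⟩ := directOffset_mem hx
      unfold directOffset at h1 h2
      simp only [cond_true]
      constructor <;> linarith
  · rintro (_ | _) x hx
    · simp only [cond_false]
      rw [show 10 + 3 * n = 7 + 3 * (n + 1) by ring, ← iterate_reverse hb (n + 1) hx]
      congr 3
      rw [reverseOffset, pow_succ]
      field_simp
      ring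
    · exact iterate_direct_succ hb hx
  · rintro (_ | _) (_ | _) hij x hx y hy
    · exact absurd rfl hij
    · exact (hne y hy x hx).ne
    · exact (hne x hx y hy).ne'
    · exact absurd rfl hij
  · rw [Fintype.sum_bool, ← hr.2]
    simp [timesPhi]

end Cases

/-! ### The parameter intervals -/

section Intervals

variable {b : ℝ} {n : ℕ}

lemma p_pred (n : ℕ) : p ((n : ℤ) - 1) = 4 * (4 * 4 ^ n - 1) / (2 * 4 ^ n + 1) := by
  rw [p, sub_add_cancel, zpow_natCast]

lemma p_natCast (n : ℕ) : p n = 4 * (16 * 4 ^ n - 1) / (8 * 4 ^ n + 1) := by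
  have : ((n : ℤ) + 1) = ((n + 1 : ℕ) : ℤ) := by push_cast; ring
  rw [p, this, zpow_natCast, pow_succ]
  ring_nf

lemma q_eq (n : ℕ) : q n = (32 * 4 ^ n + 1) / (4 * 4 ^ n + 2) := by
  rw [q, pow_succ]; ring_nf

lemma r_eq (n : ℕ) : r n = (64 * 4 ^ n - 1) / (8 * 4 ^ n + 4) := by
  rw [r, pow_succ]; ring_nf

lemma s_eq (n : ℕ) : s n = 2 * (64 * 4 ^ n - 1) / (16 * 4 ^ n + 11) := by
  rw [s, pow_add]; ring_nf

lemma one_le_four_pow (n : ℕ) : (1 : ℝ) ≤ 4 ^ n := one_le_pow₀ (by norm_num)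

lemma p_pred_lt_s (n : ℕ) : p ((n : ℤ) - 1) < s n := by
  have := one_le_four_pow n
  rw [p_pred, s_eq, div_lt_div_iff₀ (by linarith) (by linarith)]
  nlinarith

lemma s_lt_r (n : ℕ) : s n < r n := by
  have := one_le_four_pow n
  rw [s_eq, r_eq, div_lt_div_iff₀ (by linarith) (by linarith)]
  nlinarith

lemma r_lt_q (n : ℕ) : r n < q n := by
  have := one_le_four_pow n
  rw [r_eq, q_eq, div_lt_div_iff₀ (by linarith) (by linarith)]
  nlinarith

lemma q_lt_p (n : ℕ) : q n < p n := by
  have := one_le_four_pow n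
  rw [q_eq, p_natCast, div_lt_div_iff₀ (by linarith) (by linarith)]
  nlinarith

lemma p_pred_lt_p (n : ℕ) : p ((n : ℤ) - 1) < p n :=
  (p_pred_lt_s n).trans <| (s_lt_r n).trans <| (r_lt_q n).trans (q_lt_p n)

lemma strictMono_p_pred : StrictMono fun n : ℕ => p ((n : ℤ) - 1) := by
  refine strictMono_nat_of_lt_succ fun n => (p_pred_lt_p n).trans_eq ?_
  congr 1
  push_cast
  ring

/-- In terms of Q: after n turns the fundamental domain still ends left of 0. Together with
`le_p_iff`, by which the next turn reaches 0, this characterises the level. -/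
lemma p_pred_lt_iff : p ((n : ℤ) - 1) < b ↔ 4 ^ n * ((16 - 2 * b) / 3) < (b + 4) / 3 := by
  have := one_le_four_pow n
  rw [p_pred, div_lt_iff₀ (by linarith)]
  constructor <;> intro h <;> linarith

lemma le_p_iff : b ≤ p n ↔ (b + 4) / 3 ≤ 4 * (4 ^ n * ((16 - 2 * b) / 3)) := by
  have := one_le_four_pow n
  rw [p_natCast, le_div_iff₀ (by linarith)]
  constructor <;> intro h <;> linarith

lemma q_le_iff : q n ≤ b ↔ 4 ^ n * ((16 - 2 * b) / 3) ≤ (2 * b - 1) / 6 := by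
  have := one_le_four_pow n
  rw [q_eq, div_le_iff₀ (by linarith)]
  constructor <;> intro h <;> linarith

/-- Only this implication holds: s_n lies slightly above the parameter where Q = b/2. Likewise r_n
lies slightly below the one where Q = (7b+4)/24, see `le_of_le_r`. -/
lemma le_half_of_s_le (hb : 4 < b) (h : s n ≤ b) : 4 ^ n * ((16 - 2 * b) / 3) ≤ b / 2 := by
  have := one_le_four_pow n
  rw [s_eq, div_le_iff₀ (by linarith)] at h
  linarith

lemma le_of_le_r (hb : 4 < b) (h : b ≤ r n) : (7 * b + 4) / 24 ≤ 4 ^ n * ((16 - 2 * b) / 3) := by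
  have := one_le_four_pow n
  rw [r_eq, le_div_iff₀ (by linarith)] at h
  linarith

lemma four_le_p_pred (n : ℕ) : 4 ≤ p ((n : ℤ) - 1) := by
  have := one_le_four_pow n
  rw [p_pred, le_div_iff₀ (by linarith)]
  linarith

lemma p_lt_eight (n : ℕ) : p n < 8 := by
  have := one_le_four_pow n
  rw [p_natCast, div_lt_iff₀ (by linarith)]
  linarith

lemma p_pred_lt_eight (n : ℕ) : p ((n : ℤ) - 1) < 8 := (p_pred_lt_p n).trans (p_lt_eight n)

lemma mem_level_iff : b ∈ S n ∪ T n ∪ U n ∪ V n ↔ p ((n : ℤ) - 1) < b ∧ b ≤ p n := by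
  have h1 := p_pred_lt_s n
  have h2 := s_lt_r n
  have h3 := r_lt_q n
  have h4 := q_lt_p n
  simp only [S, T, U, V, mem_union, mem_Ioo, mem_Icc]
  constructor
  · rintro (((h | h) | h) | h) <;> constructor <;> linarith [h.1, h.2]
  · rintro ⟨h, h'⟩
    rcases lt_or_ge b (s n) with hs | hs
    · exact Or.inl <| Or.inl <| Or.inl ⟨h, hs⟩
    rcases le_or_gt b (r n) with hr | hr
    · exact Or.inl <| Or.inl <| Or.inr ⟨hs, hr⟩
    rcases lt_or_ge b (q n) with hq | hq
    · exact Or.inl <| Or.inr ⟨hr, hq⟩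
    · exact Or.inr ⟨hq, h'⟩

lemma exists_level (hb : 4 < b) (hb8 : b < 8) : ∃ n : ℕ, p ((n : ℤ) - 1) < b ∧ b ≤ p n := by
  classical
  have hex : ∃ n : ℕ, b ≤ p n := by
    obtain ⟨n, hn⟩ := pow_unbounded_of_one_lt ((b + 4) / (4 * (16 - 2 * b)))
      (by norm_num : (1 : ℝ) < 4)
    refine ⟨n, le_p_iff.2 ?_⟩
    rw [div_lt_iff₀ (by linarith)] at hn
    linarith
  refine ⟨Nat.find hex, ?_, Nat.find_spec hex⟩
  rcases h : Nat.find hex with _ | k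
  · rw [p_pred_lt_iff]
    simp only [pow_zero]
    linarith
  · have := Nat.find_min hex (m := k) (by omega)
    push_cast
    rw [add_sub_cancel_right]
    exact not_le.1 this

lemma Ioo_eq_iUnion_levels : Ioo (4 : ℝ) 8 = ⋃ n : ℕ, (S n ∪ T n ∪ U n ∪ V n) := by
  ext b
  rw [mem_iUnion]
  simp only [mem_level_iff]
  constructor
  · rintro ⟨h1, h2⟩
    exact exists_level h1 h2
  · rintro ⟨n, h1, h2⟩
    exact ⟨(four_le_p_pred n).trans_lt h1, h2.trans_lt (p_lt_eight n)⟩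

end Intervals

/-! ### The entropy on each parameter interval -/

section Entropy

variable {b x y : ℝ} {n : ℕ}

lemma weight_timesAlpha_lt_timesPhi {z : ℝ} (hz : 1 < z) :
    weight (timesAlpha n) z < weight (timesPhi n) z := by
  have : 0 < (z ^ (10 + 3 * n))⁻¹ := by positivity
  simp only [timesAlpha, timesPhi, weight_cons, weight_nil]
  linarith

lemma weight_timesPhi_lt_timesDelta {z : ℝ} (hz : 1 < z) :
    weight (timesPhi n) z < weight (timesDelta n) z := by
  have := inv_pow_lt hz (show 7 + 3 * n < 10 + 3 * n by omega)
  simp only [timesPhi, timesDelta, weight_cons, weight_nil]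
  linarith

lemma weight_timesDelta_lt_timesGamma {z : ℝ} (hz : 1 < z) :
    weight (timesDelta n) z < weight (timesGamma n) z := by
  have : 0 < (z ^ (10 + 3 * n))⁻¹ := by positivity
  simp only [timesDelta, timesGamma, weight_cons, weight_nil]
  linarith

lemma weight_timesGamma_lt_timesBeta {z : ℝ} (hz : 1 < z) :
    weight (timesGamma n) z < weight (timesBeta n) z := by
  have := inv_pow_lt hz (show 4 + 3 * n < 10 + 3 * n by omega)
  simp only [timesGamma, timesBeta, weight_cons, weight_nil]
  linarith

lemma weight_succ_lt {z : ℝ} (hz : 1 < z) {c : List ℕ} (hc : c ≠ []) (n : ℕ) :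
    weight (3 :: c.map fun k => k + 3 * (n + 1)) z < weight (3 :: c.map fun k => k + 3 * n) z := by
  rw [weight_cons, weight_cons, add_lt_add_iff_left]
  have h : ∀ k, (z ^ (k + 3 * (n + 1)))⁻¹ < (z ^ (k + 3 * n))⁻¹ := fun k =>
    inv_pow_lt hz (by omega)
  simp only [weight, List.map_map]
  exact List.sum_lt_sum_of_ne_nil hc _ _ fun k _ => h k

lemma coe_log_le_coe_log (hx : 0 < x) (hxy : x ≤ y) : (Real.log x : EReal) ≤ (Real.log y : EReal) :=
  EReal.coe_le_coe_iff.2 (Real.log_le_log hx hxy)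

lemma level_bounds (h : p ((n : ℤ) - 1) < b ∧ b ≤ p n) : 4 < b ∧ b < 8 :=
  ⟨(four_le_p_pred n).trans_lt h.1, h.2.trans_lt (p_lt_eight n)⟩

lemma entropy_bounds_of_mem_S (hb : b ∈ S n) {α β δ : ℝ} (hα : IsWeightRoot (timesAlpha n) α)
    (hβ : IsWeightRoot (timesBeta n) β) (hδ : IsWeightRoot (timesDelta n) δ) (hδβ : δ < β) :
    (Real.log α : EReal) ≤ entropy b ∧ entropy b ≤ (Real.log β : EReal) := by
  have hlev := mem_level_iff.1 (Or.inl (Or.inl (Or.inl hb)) : b ∈ S n ∪ T n ∪ U n ∪ V n)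
  obtain ⟨h4, h8⟩ := level_bounds hlev
  have h1 := (p_pred_lt_iff.1 hlev.1).le
  have h2 := le_of_le_r h4 (hb.2.trans (s_lt_r n)).le
  refine ⟨log_le_entropy_of_reverse h4 h8 h2 h1 hα, ?_⟩
  -- Close to s_n the interval still contains parameters with Q ≤ b/2; there the smaller root δ
  -- bounds the entropy.
  rcases le_total (b / 2) (4 ^ n * ((16 - 2 * b) / 3)) with h | h
  · exact entropy_le_of_beta h4 h8 h h1 hβ
  · exact (entropy_le_of_delta h4 h8 h2 h hδ).trans
      (coe_log_le_coe_log (zero_lt_one.trans hδ.1) hδβ.le)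

lemma entropy_eq_of_mem_T (hb : b ∈ T n) {δ : ℝ} (hδ : IsWeightRoot (timesDelta n) δ) :
    entropy b = (Real.log δ : EReal) := by
  have hlev := mem_level_iff.1 (Or.inl (Or.inl (Or.inr hb)) : b ∈ S n ∪ T n ∪ U n ∪ V n)
  obtain ⟨h4, h8⟩ := level_bounds hlev
  have h1 := le_half_of_s_le h4 hb.1
  have h2 := le_of_le_r h4 hb.2
  exact le_antisymm (entropy_le_of_delta h4 h8 h2 h1 hδ) (log_le_entropy_of_delta h4 h8 h2 h1 hδ)

lemma entropy_bounds_of_mem_U (hb : b ∈ U n) {α γ : ℝ} (hα : IsWeightRoot (timesAlpha n) α)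
    (hγ : IsWeightRoot (timesGamma n) γ) :
    (Real.log α : EReal) ≤ entropy b ∧ entropy b ≤ (Real.log γ : EReal) := by
  have hlev := mem_level_iff.1 (Or.inl (Or.inr hb) : b ∈ S n ∪ T n ∪ U n ∪ V n)
  obtain ⟨h4, h8⟩ := level_bounds hlev
  have h1 := le_half_of_s_le h4 ((s_lt_r n).trans hb.1).le
  have h2 : (2 * b - 1) / 6 ≤ 4 ^ n * ((16 - 2 * b) / 3) :=
    (not_le.1 (q_le_iff.not.1 (not_le.2 hb.2))).le
  exact ⟨log_le_entropy_of_direct h4 h8 (le_p_iff.1 hlev.2) h1 hα,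
    entropy_le_of_gamma h4 h8 h2 h1 hγ⟩

lemma entropy_eq_of_mem_V (hb : b ∈ V n) {φ : ℝ} (hφ : IsWeightRoot (timesPhi n) φ) :
    entropy b = (Real.log φ : EReal) := by
  have hlev := mem_level_iff.1 (Or.inr hb : b ∈ S n ∪ T n ∪ U n ∪ V n)
  obtain ⟨h4, h8⟩ := level_bounds hlev
  have h1 := le_p_iff.1 hb.2
  have h2 := q_le_iff.1 hb.1
  exact le_antisymm (entropy_le_of_phi h4 h8 h2 h1 hφ) (log_le_entropy_of_phi h4 h8 h1 h2 hφ)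

end Entropy

end PWLinear

/-! ### Assembly over all levels -/

open PWLinear in
theorem mainTheorem2 :
    -- the intervals `S n, T n, U n, V n` split `(4, 8)`
    (∀ n : ℕ, p ((n : ℤ) - 1) < s n ∧ s n < r n ∧ r n < q n ∧ q n < p n) ∧
    (Ioo (4 : ℝ) 8 = ⋃ n : ℕ, (S n ∪ T n ∪ U n ∪ V n)) ∧
    -- the graph is compact and invariant
    (∀ b ∈ Ioo (4 : ℝ) 8, IsCompact (Graph b) ∧ F (-1) b '' Graph b = Graph b) ∧
    -- the entropy is positive
    (∀ b ∈ Ioo (4 : ℝ) 8, 0 < entropy b) ∧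
    ∃ α β γ δ φ : ℕ → ℝ,
      (∀ n, IsUniquePosRoot (polyAlpha n) (α n)) ∧
      (∀ n, IsUniquePosRoot (polyBeta n) (β n)) ∧
      (∀ n, IsUniquePosRoot (polyGamma n) (γ n)) ∧
      (∀ n, IsUniquePosRoot (polyDelta n) (δ n)) ∧
      (∀ n, IsUniquePosRoot (polyPhi n) (φ n)) ∧
      (∀ n, ∀ b ∈ S n,
        (Real.log (α n) : EReal) ≤ entropy b ∧ entropy b ≤ (Real.log (β n) : EReal)) ∧
      (∀ n, ∀ b ∈ T n, entropy b = (Real.log (δ n) : EReal)) ∧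
      (∀ n, ∀ b ∈ U n,
        (Real.log (α n) : EReal) ≤ entropy b ∧ entropy b ≤ (Real.log (γ n) : EReal)) ∧
      (∀ n, ∀ b ∈ V n, entropy b = (Real.log (φ n) : EReal)) ∧
      (∀ n, 1 < α n ∧ α n < φ n ∧ φ n < δ n ∧ δ n < γ n ∧ γ n < β n) ∧
      (StrictAnti α ∧ StrictAnti β ∧ StrictAnti γ ∧ StrictAnti δ ∧ StrictAnti φ) ∧
      (Tendsto α atTop (𝓝 1) ∧ Tendsto β atTop (𝓝 1) ∧ Tendsto γ atTop (𝓝 1) ∧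
        Tendsto δ atTop (𝓝 1) ∧ Tendsto φ atTop (𝓝 1)) ∧
      -- the entropy on the `n`-th level tends to `0`, uniformly in `b`
      (∀ ε : ℝ, 0 < ε → ∃ N : ℕ, ∀ n ≥ N, ∀ b ∈ S n ∪ T n ∪ U n ∪ V n,
        entropy b < (ε : EReal)) ∧
      Tendsto entropy (𝓝[<] (8 : ℝ)) (𝓝 0) := by
  have hex : ∀ l : ℕ → List ℕ, (∀ n, ∀ k ∈ l n, 0 < k) → (∀ n, 2 ≤ (l n).length) →
      ∃ x : ℕ → ℝ, ∀ n, IsWeightRoot (l n) (x n) := fun l hl h2 =>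
    ⟨fun n => (exists_weight_eq_one (hl n) (h2 n)).choose,
      fun n => (exists_weight_eq_one (hl n) (h2 n)).choose_spec⟩
  obtain ⟨α, hα⟩ := hex timesAlpha (by simp [timesAlpha]) (by simp [timesAlpha])
  obtain ⟨β, hβ⟩ := hex timesBeta (by simp [timesBeta]) (by simp [timesBeta])
  obtain ⟨γ, hγ⟩ := hex timesGamma (by simp [timesGamma]) (by simp [timesGamma])
  obtain ⟨δ, hδ⟩ := hex timesDelta (by simp [timesDelta]) (by simp [timesDelta])
  obtain ⟨φ, hφ⟩ := hex timesPhi (by simp [timesPhi]) (by simp [timesPhi])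
  have hαφ : ∀ n, α n < φ n := fun n => (hα n).lt (hφ n) fun _ => weight_timesAlpha_lt_timesPhi
  have hφδ : ∀ n, φ n < δ n := fun n => (hφ n).lt (hδ n) fun _ => weight_timesPhi_lt_timesDelta
  have hδγ : ∀ n, δ n < γ n := fun n => (hδ n).lt (hγ n) fun _ => weight_timesDelta_lt_timesGamma
  have hγβ : ∀ n, γ n < β n := fun n => (hγ n).lt (hβ n) fun _ => weight_timesGamma_lt_timesBeta
  have anti : ∀ (c : List ℕ), c ≠ [] → ∀ x : ℕ → ℝ,
      (∀ n, IsWeightRoot (3 :: c.map fun k => k + 3 * n) (x n)) →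
      StrictAnti x ∧ Tendsto x atTop (𝓝 1) := fun c hc x hx =>
    ⟨strictAnti_nat_of_succ_lt fun n => (hx (n + 1)).lt (hx n) fun _ hz => weight_succ_lt hz hc n,
      IsWeightRoot.tendsto_one hx fun _ hz => eventually_weight_lt_one hz c⟩
  -- Each list of times is by definition 3 followed by a fixed list shifted by 3n.
  have aα := anti [7] (by simp) α hα
  have aβ := anti [4, 7, 7] (by simp) β hβ
  have aγ := anti [7, 7, 10] (by simp) γ hγ
  have aδ := anti [7, 7] (by simp) δ hδ
  have aφ := anti [7, 10] (by simp) φ hφ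
  have hS : ∀ n, ∀ b ∈ S n,
      (Real.log (α n) : EReal) ≤ entropy b ∧ entropy b ≤ (Real.log (β n) : EReal) := fun n b hb =>
    entropy_bounds_of_mem_S hb (hα n) (hβ n) (hδ n) ((hδγ n).trans (hγβ n))
  have hT : ∀ n, ∀ b ∈ T n, entropy b = (Real.log (δ n) : EReal) := fun n b hb =>
    entropy_eq_of_mem_T hb (hδ n)
  have hU : ∀ n, ∀ b ∈ U n,
      (Real.log (α n) : EReal) ≤ entropy b ∧ entropy b ≤ (Real.log (γ n) : EReal) := fun n b hb =>
    entropy_bounds_of_mem_U hb (hα n) (hγ n)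
  have hV : ∀ n, ∀ b ∈ V n, entropy b = (Real.log (φ n) : EReal) := fun n b hb =>
    entropy_eq_of_mem_V hb (hφ n)
  have hlevel : ∀ n, ∀ b ∈ S n ∪ T n ∪ U n ∪ V n,
      (Real.log (α n) : EReal) ≤ entropy b ∧ entropy b ≤ (Real.log (β n) : EReal) := by
    intro n b hb
    have h0 := zero_lt_one.trans (hα n).1
    have h1 := hαφ n
    have h2 := hφδ n
    have h3 := hδγ n
    have h4 := hγβ n
    rcases hb with ((hb | hb) | hb) | hb
    · exact hS n b hb
    · rw [hT n b hb]
      exact ⟨coe_log_le_coe_log h0 (by linarith), coe_log_le_coe_log (by linarith) (by linarith)⟩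
    · exact ⟨(hU n b hb).1, (hU n b hb).2.trans (coe_log_le_coe_log (by linarith) h4.le)⟩
    · rw [hV n b hb]
      exact ⟨coe_log_le_coe_log h0 (by linarith), coe_log_le_coe_log (by linarith) (by linarith)⟩
  have hpos : ∀ b ∈ Ioo (4 : ℝ) 8, 0 < entropy b := by
    intro b hb
    rw [Ioo_eq_iUnion_levels, mem_iUnion] at hb
    obtain ⟨n, hn⟩ := hb
    exact lt_of_lt_of_le (EReal.coe_pos.2 (Real.log_pos (hα n).1)) (hlevel n b hn).1
  have hunif : ∀ ε : ℝ, 0 < ε → ∃ N : ℕ, ∀ n ≥ N, ∀ b ∈ S n ∪ T n ∪ U n ∪ V n,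
      entropy b < (ε : EReal) := by
    intro ε hε
    have hlim : Tendsto (fun n => Real.log (β n)) atTop (𝓝 0) := by
      rw [← Real.log_one]
      exact aβ.2.log one_ne_zero
    obtain ⟨N, hN⟩ := eventually_atTop.1 (hlim.eventually (gt_mem_nhds hε))
    exact ⟨N, fun n hn b hb => (hlevel n b hb).2.trans_lt (EReal.coe_lt_coe_iff.2 (hN n hn))⟩
  refine ⟨fun n => ⟨p_pred_lt_s n, s_lt_r n, r_lt_q n, q_lt_p n⟩, Ioo_eq_iUnion_levels,
    fun b hb => ⟨isCompact_graph hb.1, image_graph hb.1⟩, hpos, α, β, γ, δ, φ,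
    fun n => (hα n).isUniquePosRoot (by simp [timesAlpha]) (by simp [timesAlpha])
      fun _ => isRoot_polyAlpha n,
    fun n => (hβ n).isUniquePosRoot (by simp [timesBeta]) (by simp [timesBeta])
      fun _ => isRoot_polyBeta n,
    fun n => (hγ n).isUniquePosRoot (by simp [timesGamma]) (by simp [timesGamma])
      fun _ => isRoot_polyGamma n,
    fun n => (hδ n).isUniquePosRoot (by simp [timesDelta]) (by simp [timesDelta])
      fun _ => isRoot_polyDelta n,
    fun n => (hφ n).isUniquePosRoot (by simp [timesPhi]) (by simp [timesPhi])
      fun _ => isRoot_polyPhi n,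
    hS, hT, hU, hV, fun n => ⟨(hα n).1, hαφ n, hφδ n, hδγ n, hγβ n⟩,
    ⟨aα.1, aβ.1, aγ.1, aδ.1, aφ.1⟩, ⟨aα.2, aβ.2, aγ.2, aδ.2, aφ.2⟩, hunif, ?_⟩
  rw [tendsto_order]
  constructor
  · intro a ha
    filter_upwards [Ioo_mem_nhdsLT (by norm_num : (4 : ℝ) < 8)] with b hb
    exact ha.trans (hpos b hb)
  · intro a ha
    obtain ⟨ε, hε, hεa⟩ := EReal.lt_iff_exists_real_btwn.1 ha
    obtain ⟨N, hN⟩ := hunif ε (EReal.coe_pos.1 hε)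
    filter_upwards [Ioo_mem_nhdsLT (p_pred_lt_eight N)] with b hb
    obtain ⟨n, hn⟩ := exists_level ((four_le_p_pred N).trans_lt hb.1) hb.2
    refine (hN n ?_ b (mem_level_iff.2 hn)).trans hεa
    -- A level n < N would give b ≤ p_n ≤ p_{N-1} < b.
    by_contra! hlt
    have h1 : p (((n + 1 : ℕ) : ℤ) - 1) ≤ p ((N : ℤ) - 1) :=
      strictMono_p_pred.monotone (Nat.succ_le_of_lt hlt)
    rw [Nat.cast_succ, add_sub_cancel_right] at h1
    linarith [hn.2, hb.1]
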